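/- **Network codes and achievability.** A network is a finite directed acyclic graph $(\mathcal P,\mathcal E)$; a connection requirement gives for each session $s\in\mathcal S$ its originating node and the set of nodes that require $s$. In a network code the source messages $T_s$ are independent and uniform on finite alphabets; each link message $W_e$, with values in a finite alphabet of size $|w_e|$, is a function of the source messages originating at the tail of $e$, the messages on the links entering that tail, and finite-valued internal randomness of the tail (independent over nodes, and independent of the sources). Likewise a receiver estimates the sessions it requires from the data available at its node. $P_e$ is the probability that at least one receiver fails to reconstruct at least one session it requires. A tuple of source rates $\lambda_s\in\mathbb R$ and link capacities $\omega_e\in\mathbb R\cup\{\infty\}$ ($\infty$ meaning uncapacitated) is *achievable* if there are network codes indexed by $n$ and constants $r(n)>0$ such that all the following limits exist in $\mathbb R$ and $$\lim_n \tfrac{H(W_e^{(n)})}{r(n)}\le\lim_n\tfrac{\log|w_e^{(n)}|}{r(n)}\le\omega_e \ (\text{whenever }\omega_e<\infty),\qquad \lim_n \tfrac{H(T_s^{(n)})}{r(n)}=\lim_n\tfrac{\log|T_s^{(n)}|}{r(n)}\ge\lambda_s\ (\text{all } s),\qquad \lim_n P_e^{(n)}=0 .$$ Logarithms are to base $2$.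 **Entropic functions.** Let $\mathcal N=\{1,\dots,N\}$. A function $h:2^{\mathcal N}\to\mathbb R$ with $h(\emptyset)=0$ is *entropic* if there are discrete random variables $X_1,\dots,X_N$ such that $H(X_j:j\in\alpha)=h(\alpha)$ for every $\alpha\subseteq\mathcal N$; it is *almost entropic* if it is a limit of a sequence of entropic functions. $\Gamma^*$ denotes the set of entropic functions. **The network $G^\dagger$, the requirement $M^\dagger$ and the tuple $\mathsf T(h)$.** Write $h(i)=h(\{i\})$ and $h(\alpha,i)=h(\alpha\cup\{i\})$. One source node has two sessions $S_0,S_1$, of rates $\sum_{i}h(i)$ and $h(\mathcal N)$. All links with no stated capacity are uncapacitated. * Source part: for each $j\in\mathcal N$ there are links carrying $U_j$ and $V_j$, each of capacity $h(j)$, from the source to two separate nodes, from which they are forwarded as needed. * Type 1, for each $\emptyset\ne\alpha\subseteq\mathcal N$: a link of capacity $h(\mathcal N)-h(\alpha)$ from the source to a sink requiring $S_1$; an intermediate node receives $V_j$, $j\in\alpha$, and has a link of capacity $h(\alpha)$ to that sink. * Type 2, for each $\emptyset\neq\alpha\subset\mathcal N$ and $i\in\mathcal N\setminus\alpha$: a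 link of capacity $h(\mathcal N)+\sum_{j}h(j)-2h(i)$ from the source to an upper receiver, which requires $S_0$ and $S_1$. A node receiving $U_i$ and $V_i$ emits $W_1$ (capacity $h(i)$), which is duplicated and forwarded to nodes $P_0$ and $P_1$. A link $W_2$ of capacity $h(i)$ goes from the node holding $U_i$ to $P_0$, and $P_0$ has a link to the upper receiver. A node receiving $V_i$ and $V_j$, $j\in\alpha$, emits $W_4$ (capacity $h(\alpha,i)-h(\alpha)$) to $P_1$; $P_1$ also receives $V_j$, $j\in\alpha$. Node $P_1$ has a link $W_3$ of capacity $h(i)$ to a lower receiver, which requires $S_0$ and also receives $U_j$, $j\ne i$. The network and the connection requirement depend only on $N$; $h$ enters only through the rates and capacities. **Theorem.** For every $N$ and every $h:2^{\mathcal N}\to\mathbb R$ with $h(\emptyset)=0$, the rate-capacity tuple $\mathsf T(h)$ is achievable on $G^\dagger$ with connection requirement $M^\dagger$ if and only if $h$ is almost entropic. Consequently, for this single-source, two-session multicast problem, the set of all $h$ with $h(\emptyset)=0$ for which $\mathsf T(h)$ is achievable is exactly the closure $\overline{\Gamma^*}$. -/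

import Mathlib

open Filter Topology

namespace NetworkCoding

/-! ## Entropy (in bits) and independent products of finite laws -/

/-- The discrete law `q` has finite Shannon entropy, equal to `v` bits. -/
def HasEntropy {A : Type*} (q : PMF A) (v : ℝ) : Prop :=
  HasSum (fun a => Real.negMulLog (q a).toReal / Real.log 2) v

/-- Shannon entropy in bits. It is used only for laws on finite types, where the sum is finite. -/
noncomputable def entropy {A : Type*} (q : PMF A) : ℝ :=
  ∑' a, Real.negMulLog (q a).toReal / Real.log 2

open Classical in
/-- The joint law of independent variables with laws `q i`. -/
noncomputable def independentProduct {ι : Type} [Fintype ι] {A : ι → Type}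
    [∀ i, Fintype (A i)] (q : ∀ i, PMF (A i)) : PMF (∀ i, A i) :=
  PMF.ofFintype (fun x => ∏ i, q i (x i)) (by
    have h := Finset.prod_univ_sum (fun i => (Finset.univ : Finset (A i))) (fun i a => q i a)
    rw [Fintype.piFinset_univ] at h
    rw [← h]
    refine Finset.prod_eq_one fun i _ => ?_
    rw [← tsum_fintype (L := .unconditional _)]
    exact (q i).tsum_coe)

/-! ## Networks, connection requirements and network codes -/

/-- A directed acyclic graph with nodes `P` and links `E`. -/
structure Network (P E : Type) where
  tail : E → P
  head : E → P
  acyclic : ∀ u, ¬ Relation.TransGen (fun a b => ∃ e, tail e = a ∧ head e = b) u u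

/-- Sessions `S`, the node where each originates, and the nodes that require it. -/
structure ConnectionRequirement (P S : Type) where
  origin : S → P
  dest : S → Set P

/-- A (possibly probabilistic) network code. The sample space consists of all pairs `(t, v)` of
source messages and internal randomness of the nodes; `msg e` is the random variable `W_e`. A link
message is a function of the sources, the incoming link messages and the internal randomness at the
tail of the link; an estimate of a session at a node is a function of the same data at that node. -/
structure NetworkCode {P E S : Type} (G : Network P E) (M : ConnectionRequirement P S) where
  Src : S → Type
  Msg : E → Type
  Rnd : P → Type
  [fintypeSrc : ∀ s, Fintype (Src s)]
  [nonemptySrc : ∀ s, Nonempty (Src s)]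
  [fintypeMsg : ∀ e, Fintype (Msg e)]
  [fintypeRnd : ∀ u, Fintype (Rnd u)]
  rndLaw : ∀ u, PMF (Rnd u)
  encode : ∀ e, (∀ s : {s // M.origin s = G.tail e}, Src s) →
    (∀ d : {d // G.head d = G.tail e}, Msg d) → Rnd (G.tail e) → Msg e
  decode : ∀ u s, (∀ s' : {s' // M.origin s' = u}, Src s') →
    (∀ d : {d // G.head d = u}, Msg d) → Rnd u → Src s
  msg : ∀ e, (∀ s, Src s) × (∀ u, Rnd u) → Msg e
  causal : ∀ e ω, msg e ω =
    encode e (fun s => ω.1 s) (fun d => msg d ω) (ω.2 (G.tail e))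

attribute [instance] NetworkCode.fintypeSrc NetworkCode.nonemptySrc NetworkCode.fintypeMsg
  NetworkCode.fintypeRnd

section Codes

variable {P E S : Type} [Fintype P] [Fintype S] {G : Network P E} {M : ConnectionRequirement P S}

/-- Joint law of source messages and internal randomness: everything is independent, and the
source messages are uniform. -/
noncomputable def NetworkCode.jointLaw (C : NetworkCode G M) :
    PMF ((∀ s, C.Src s) × (∀ u, C.Rnd u)) :=
  (independentProduct fun s => PMF.uniformOfFintype (C.Src s)).bind fun t =>
    (independentProduct C.rndLaw).map fun v => (t, v)

/-- The entropy of the message `W_e`. -/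
noncomputable def NetworkCode.msgEntropy (C : NetworkCode G M) (e : E) : ℝ :=
  entropy (C.jointLaw.map (C.msg e))

/-- The entropy of the source message `T_s`. -/
noncomputable def NetworkCode.srcEntropy (C : NetworkCode G M) (s : S) : ℝ :=
  entropy (C.jointLaw.map fun ω => ω.1 s)

/-- The estimate of session `s` formed at node `u`. -/
def NetworkCode.estimate (C : NetworkCode G M) (u : P) (s : S)
    (ω : (∀ s, C.Src s) × (∀ u, C.Rnd u)) : C.Src s :=
  C.decode u s (fun s' => ω.1 s') (fun d => C.msg d ω) (ω.2 u)

/-- The probability that at least one receiver fails to reconstruct a session it requires. -/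
noncomputable def NetworkCode.errorProb (C : NetworkCode G M) : ℝ :=
  (C.jointLaw.toOuterMeasure {ω | ∃ s, ∃ u ∈ M.dest s, C.estimate u s ω ≠ ω.1 s}).toReal

/-- Achievability of source rates `rate` and link capacities `cap` (`⊤` for an uncapacitated link)
by a sequence of network codes with vanishing probability of error. -/
def Achievable (G : Network P E) (M : ConnectionRequirement P S)
    (rate : S → ℝ) (cap : E → WithTop ℝ) : Prop :=
  ∃ (C : ℕ → NetworkCode G M) (r : ℕ → ℝ), (∀ n, 0 < r n) ∧
    (∀ e, ∀ c : ℝ, cap e = (c : WithTop ℝ) → ∃ a b : ℝ,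
      Tendsto (fun n => (C n).msgEntropy e / r n) atTop (𝓝 a) ∧
      Tendsto (fun n => Real.logb 2 (Fintype.card ((C n).Msg e)) / r n) atTop (𝓝 b) ∧
      a ≤ b ∧ b ≤ c) ∧
    (∀ s, ∃ b : ℝ,
      Tendsto (fun n => (C n).srcEntropy s / r n) atTop (𝓝 b) ∧
      Tendsto (fun n => Real.logb 2 (Fintype.card ((C n).Src s)) / r n) atTop (𝓝 b) ∧
      rate s ≤ b) ∧
    Tendsto (fun n => (C n).errorProb) atTop (𝓝 0)

end Codes

/-! ## Entropic and almost entropic functions -/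

/-- `h α` is the joint entropy of `X_j`, `j ∈ α`, for some discrete random variables
`X_1, …, X_N`. A discrete variable may be taken to be `ℕ`-valued; `p` is the joint law. -/
def IsEntropic {N : ℕ} (h : Finset (Fin N) → ℝ) : Prop :=
  ∃ p : PMF (Fin N → ℕ), ∀ α : Finset (Fin N), HasEntropy (p.map fun x (j : α) => x j) (h α)

/-- The limit of a sequence of entropic functions. -/
def IsAlmostEntropic {N : ℕ} (h : Finset (Fin N) → ℝ) : Prop :=
  ∃ f : ℕ → Finset (Fin N) → ℝ, (∀ k, IsEntropic (f k)) ∧ Tendsto f atTop (𝓝 h)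

/-! ## The network -/

/-- Indices of the type 1 subnetworks: nonempty subsets of the ground set. -/
abbrev Index1 (N : ℕ) : Type := {α : Finset (Fin N) // α.Nonempty}

/-- Indices of the type 2 subnetworks: a nonempty subset and an element outside it. -/
abbrev Index2 (N : ℕ) : Type := {x : Finset (Fin N) × Fin N // x.1.Nonempty ∧ x.2 ∉ x.1}

/-- The nodes. `dupU j` and `dupV j` duplicate `U_j` and `V_j`; `mid` and `sink` belong to the
type 1 subnetworks; the others belong to the type 2 subnetworks. -/
inductive DaggerNode (N : ℕ) : Type
  | source
  | dupU (j : Fin N)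
  | dupV (j : Fin N)
  | mid (α : Index1 N)
  | sink (α : Index1 N)
  | coder (x : Index2 N)
  | fork (x : Index2 N)
  | helper (x : Index2 N)
  | nodeP0 (x : Index2 N)
  | nodeP1 (x : Index2 N)
  | upper (x : Index2 N)
  | lower (x : Index2 N)
  deriving DecidableEq, Fintype

set_option synthInstance.maxHeartbeats 400000 in
set_option synthInstance.maxSize 2000 in
/-- The links. -/
inductive DaggerEdge (N : ℕ) : Type
  -- the source part
  | U (j : Fin N)
  | V (j : Fin N)
  -- type 1 subnetworks
  | direct1 (α : Index1 N)
  | carryV1 (α : Index1 N) (j : {j // j ∈ α.1})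
  | out1 (α : Index1 N)
  -- type 2 subnetworks, the part leading to the upper receiver
  | direct2 (x : Index2 N)
  | coderU (x : Index2 N)
  | coderV (x : Index2 N)
  | linkW1 (x : Index2 N)
  | forkP0 (x : Index2 N)
  | forkP1 (x : Index2 N)
  | linkW2 (x : Index2 N)
  | outP0 (x : Index2 N)
  -- type 2 subnetworks, the part leading to the lower receiver
  | helperVi (x : Index2 N)
  | helperV (x : Index2 N) (j : {j // j ∈ x.1.1})
  | linkW4 (x : Index2 N)
  | carryV2 (x : Index2 N) (j : {j // j ∈ x.1.1})
  | linkW3 (x : Index2 N)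
  | carryU2 (x : Index2 N) (j : {j // j ≠ x.1.2})
  deriving DecidableEq, Fintype

namespace DaggerEdge

variable {N : ℕ}

def tail : DaggerEdge N → DaggerNode N
  | U _ => .source
  | V _ => .source
  | direct1 _ => .source
  | carryV1 _ j => .dupV j
  | out1 α => .mid α
  | direct2 _ => .source
  | coderU x => .dupU x.1.2
  | coderV x => .dupV x.1.2
  | linkW1 x => .coder x
  | forkP0 x => .fork x
  | forkP1 x => .fork x
  | linkW2 x => .dupU x.1.2
  | outP0 x => .nodeP0 x
  | helperVi x => .dupV x.1.2
  | helperV _ j => .dupV j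
  | linkW4 x => .helper x
  | carryV2 _ j => .dupV j
  | linkW3 x => .nodeP1 x
  | carryU2 _ j => .dupU j

def head : DaggerEdge N → DaggerNode N
  | U j => .dupU j
  | V j => .dupV j
  | direct1 α => .sink α
  | carryV1 α _ => .mid α
  | out1 α => .sink α
  | direct2 x => .upper x
  | coderU x => .coder x
  | coderV x => .coder x
  | linkW1 x => .fork x
  | forkP0 x => .nodeP0 x
  | forkP1 x => .nodeP1 x
  | linkW2 x => .nodeP0 x
  | outP0 x => .upper x
  | helperVi x => .helper x
  | helperV x _ => .helper x
  | linkW4 x => .nodeP1 x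
  | carryV2 x _ => .nodeP1 x
  | linkW3 x => .lower x
  | carryU2 x _ => .lower x

end DaggerEdge

/-- A level that increases along every link. -/
def DaggerNode.level {N : ℕ} : DaggerNode N → ℕ
  | .source => 0
  | .dupU _ => 1
  | .dupV _ => 1
  | .mid _ => 2
  | .coder _ => 2
  | .helper _ => 2
  | .fork _ => 3
  | .nodeP0 _ => 4
  | .nodeP1 _ => 4
  | .sink _ => 5
  | .upper _ => 5
  | .lower _ => 5

/-- The network; it depends only on `N`. -/
def daggerNetwork (N : ℕ) : Network (DaggerNode N) (DaggerEdge N) where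
  tail := DaggerEdge.tail
  head := DaggerEdge.head
  acyclic := by
    have key : ∀ a b : DaggerNode N,
        Relation.TransGen (fun a b => ∃ e, DaggerEdge.tail e = a ∧ DaggerEdge.head e = b) a b →
        a.level < b.level := by
      intro a b h
      have step : ∀ e : DaggerEdge N, e.tail.level < e.head.level := by
        intro e
        cases e <;> simp [DaggerEdge.tail, DaggerEdge.head, DaggerNode.level]
      induction h with
      | single h =>
        obtain ⟨e, rfl, rfl⟩ := h
        exact step e
      | tail _ h ih =>
        obtain ⟨e, rfl, rfl⟩ := h
        exact ih.trans (step e)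
    exact fun u hu => lt_irrefl _ (key u u hu)

/-- The connection requirement: both sessions `S_0`, `S_1` originate at the source; type 1 sinks
require `S_1`, upper receivers require `S_0` and `S_1`, lower receivers require `S_0`. -/
def daggerRequirement (N : ℕ) : ConnectionRequirement (DaggerNode N) (Fin 2) where
  origin := fun _ => .source
  dest := ![{u | ∃ x, u = .upper x ∨ u = .lower x},
    {u | (∃ α, u = .sink α) ∨ ∃ x, u = .upper x}]

/-- The source rates built from `h`. -/
def daggerRate {N : ℕ} (h : Finset (Fin N) → ℝ) : Fin 2 → ℝ :=
  ![∑ j, h {j}, h Finset.univ]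

/-- The link capacities built from `h`. -/
def daggerCapacity {N : ℕ} (h : Finset (Fin N) → ℝ) : DaggerEdge N → WithTop ℝ
  | .U j => ((h {j} : ℝ) : WithTop ℝ)
  | .V j => ((h {j} : ℝ) : WithTop ℝ)
  | .direct1 α => ((h Finset.univ - h α.1 : ℝ) : WithTop ℝ)
  | .carryV1 _ _ => ⊤
  | .out1 α => ((h α.1 : ℝ) : WithTop ℝ)
  | .direct2 x => ((h Finset.univ + ∑ j, h {j} - 2 * h {x.1.2} : ℝ) : WithTop ℝ)
  | .coderU _ => ⊤
  | .coderV _ => ⊤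
  | .linkW1 x => ((h {x.1.2} : ℝ) : WithTop ℝ)
  | .forkP0 _ => ⊤
  | .forkP1 _ => ⊤
  | .linkW2 x => ((h {x.1.2} : ℝ) : WithTop ℝ)
  | .outP0 _ => ⊤
  | .helperVi _ => ⊤
  | .helperV _ _ => ⊤
  | .linkW4 x => ((h (insert x.1.2 x.1.1) - h x.1.1 : ℝ) : WithTop ℝ)
  | .carryV2 _ _ => ⊤
  | .linkW3 x => ((h {x.1.2} : ℝ) : WithTop ℝ)
  | .carryU2 _ _ => ⊤

end NetworkCoding

/-! Sufficiency rests on the group description of entropy: after normalization, an almost entropic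
function is a limit of α ↦ log [G : ⋂_{j∈α} K j] for subgroups of finite groups
(`IsAlmostEntropic.exists_subgroups`). The groups consist of permutations of the positions of a long
word, and the K j are stabilizers of coordinate words. Such data give a code without errors
(`exists_groupCode`): S_1 is a coset of ⋂ K j, V_j is the coset of K j containing it, and U_j is an
independent coset of K j. A coset splits evenly into cosets of a smaller subgroup, so every
conditional description has an alphabet whose size is exactly an index ratio, and all capacities are
met with equality. W_1 combines U_i and V_i by a Latin square, so each is recovered from W_1 and the
other.

For necessity, fix a value of the internal randomness that is at least as good as average and keep
only the set Ω of source tuples on which no receiver fails, with the uniform law. Little is lost in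
log |Ω|, and decoding on Ω is exact, so Shannon inequalities suffice, up to small errors. Type 1
sinks give H(V_α) ≥ h(α) and, for singletons, make each V_j nearly a function of S_1. In type 2
subnetworks the upper receiver forces V_i to be nearly a function of U_i and W_1; the lower
receivers make U_i nearly a function of S_0 and let W_1, W_4, V_α and the U_j, j ≠ i, determine S_0.
Counting bits gives H(V_{α∪i}) - H(V_α) ≤ h(α∪i) - h(α), and induction on α yields H(V_α) ≈ h(α)
(`abs_entropy_tupleV_sub_le`).

These entropies still have to be divided by the scale r of the code. This is harmless because
positive multiples of entropic functions are almost entropic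
(`IsEntropic.isAlmostEntropic_const_mul`): reveal large group variables jointly with small
probability and erase them all otherwise. -/

namespace NetworkCoding

/-! ## Entropy of functions on a finite space with uniform law -/

section UniformEntropy

variable {Ω A B C D : Type*} [Fintype Ω]

open Classical in
/-- The number of points at which `X` takes the same value as at `ω`. -/
noncomputable def cellCard (X : Ω → A) (ω : Ω) : ℕ :=
  (Finset.univ.filter fun ω' => X ω' = X ω).card

/-- The entropy in bits of `X` when `Ω` carries the uniform law. -/
noncomputable def uniformEntropy (X : Ω → A) : ℝ :=
  (∑ ω, Real.logb 2 (Fintype.card Ω / cellCard X ω)) / Fintype.card Ω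

theorem cellCard_pos (X : Ω → A) (ω : Ω) : 0 < cellCard X ω :=
  Finset.card_pos.2 ⟨ω, by simp⟩

theorem cellCard_congr {X : Ω → A} {ω ω' : Ω} (h : X ω = X ω') :
    cellCard X ω = cellCard X ω' := by
  unfold cellCard
  congr 1
  ext ω''
  simp [h]

theorem cellCard_le_card (X : Ω → A) (ω : Ω) : cellCard X ω ≤ Fintype.card Ω := by
  classical exact Finset.card_le_univ _

theorem uniformEntropy_nonneg (X : Ω → A) : 0 ≤ uniformEntropy X := by
  refine div_nonneg (Finset.sum_nonneg fun ω _ => ?_) (Nat.cast_nonneg _)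
  refine Real.logb_nonneg (by norm_num) ?_
  rw [one_le_div (by exact_mod_cast cellCard_pos X ω)]
  exact_mod_cast cellCard_le_card X ω

/-- A function of `X` has at most the entropy of `X`. -/
theorem uniformEntropy_le_of_determined {X : Ω → A} {Y : Ω → B}
    (h : ∀ ω ω', X ω = X ω' → Y ω = Y ω') : uniformEntropy Y ≤ uniformEntropy X := by
  classical
  refine div_le_div_of_nonneg_right (Finset.sum_le_sum fun ω _ => ?_) (Nat.cast_nonneg _)
  have h1 : (0 : ℝ) < cellCard X ω := by exact_mod_cast cellCard_pos X ω
  have h2 : (0 : ℝ) < cellCard Y ω := by exact_mod_cast cellCard_pos Y ω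
  have h3 : (0 : ℝ) < Fintype.card Ω := by exact_mod_cast Fintype.card_pos_iff.2 ⟨ω⟩
  refine Real.logb_le_logb_of_le (by norm_num) (by positivity) ?_
  refine div_le_div_of_nonneg_left h3.le h1 ?_
  exact_mod_cast Finset.card_le_card (fun ω' h' => by
    simp only [Finset.mem_filter, Finset.mem_univ, true_and] at h' ⊢
    exact h _ _ h')

theorem uniformEntropy_of_subsingleton_range {X : Ω → A} (h : ∀ ω ω', X ω = X ω') :
    uniformEntropy X = 0 := by
  classical
  have : ∀ ω, Real.logb 2 (Fintype.card Ω / cellCard X ω) = 0 := fun ω => by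
    have h3 : (Fintype.card Ω : ℝ) ≠ 0 := by exact_mod_cast (Fintype.card_pos_iff.2 ⟨ω⟩).ne'
    have : cellCard X ω = Fintype.card Ω := by
      simp [cellCard, h _ ω, Finset.card_univ]
    rw [this, div_self h3, Real.logb_one]
  simp [uniformEntropy, this]

theorem uniformEntropy_of_injective {X : Ω → A} (h : Function.Injective X) :
    uniformEntropy X = Real.logb 2 (Fintype.card Ω) := by
  classical
  have : ∀ ω, cellCard X ω = 1 := fun ω => by
    rw [cellCard, Finset.card_eq_one]
    exact ⟨ω, by ext ω'; simp [h.eq_iff]⟩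
  rcases isEmpty_or_nonempty Ω with hΩ | hΩ
  · simp [uniformEntropy]
  · have h3 : (Fintype.card Ω : ℝ) ≠ 0 := by exact_mod_cast Fintype.card_ne_zero
    simp [uniformEntropy, this, Finset.card_univ, h3]

/-- This is the expectation bound E[p(x)p(y) / (p(w)p(z))] ≤ 1 behind submodularity. It is proved by
counting triples (a, b, ω) with a in the X-cell and b in the Y-cell of ω, summing over ω first. -/
theorem sum_cellCard_ratio_le {X : Ω → A} {Y : Ω → B} {Z : Ω → C} {W : Ω → D}
    (hW : ∀ ω ω', X ω = X ω' → Y ω = Y ω' → W ω = W ω')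
    (hX : ∀ ω ω', X ω = X ω' → Z ω = Z ω') (hY : ∀ ω ω', Y ω = Y ω' → Z ω = Z ω') :
    ∑ ω, (cellCard X ω * cellCard Y ω : ℝ) / (cellCard W ω * cellCard Z ω) ≤
      Fintype.card Ω := by
  classical
  have hcellX : ∀ ω, (cellCard X ω : ℝ) = ∑ a, if X a = X ω then (1 : ℝ) else 0 := by
    intro ω; simp [cellCard]
  have hcellY : ∀ ω, (cellCard Y ω : ℝ) = ∑ a, if Y a = Y ω then (1 : ℝ) else 0 := by
    intro ω; simp [cellCard]
  calc ∑ ω, (cellCard X ω * cellCard Y ω : ℝ) / (cellCard W ω * cellCard Z ω)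
      = ∑ ω, ∑ a, ∑ b, (if X a = X ω then (1 : ℝ) else 0) * (if Y b = Y ω then (1 : ℝ) else 0) /
          (cellCard W ω * cellCard Z ω) := by
        refine Finset.sum_congr rfl fun ω _ => ?_
        rw [hcellX, hcellY, Finset.sum_mul_sum, Finset.sum_div]
        exact Finset.sum_congr rfl fun a _ => by rw [Finset.sum_div]
    _ = ∑ a, ∑ b, ∑ ω, (if X a = X ω then (1 : ℝ) else 0) * (if Y b = Y ω then (1 : ℝ) else 0) /
          (cellCard W ω * cellCard Z ω) := by
        rw [Finset.sum_comm]
        exact Finset.sum_congr rfl fun a _ => Finset.sum_comm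
    _ ≤ ∑ a, ∑ b, (if Z b = Z a then (1 : ℝ) else 0) / cellCard Z a := by
        refine Finset.sum_le_sum fun a _ => Finset.sum_le_sum fun b _ => ?_
        have hz : (0 : ℝ) < cellCard Z a := by exact_mod_cast cellCard_pos Z a
        -- All of `S` lies in one W-cell, so each weight is at most 1 / (|S| · |Z-cell|) and the sum
        -- over `S` is at most 1 / |Z-cell|. If `S` is nonempty, then a and b share their Z-value.
        set S := Finset.univ.filter fun ω => X a = X ω ∧ Y b = Y ω with hS
        have e : ∀ ω, (if X a = X ω then (1 : ℝ) else 0) * (if Y b = Y ω then (1 : ℝ) else 0) /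
            (cellCard W ω * cellCard Z ω) =
            if X a = X ω ∧ Y b = Y ω then 1 / (cellCard W ω * cellCard Z ω : ℝ) else 0 := by
          intro ω
          by_cases h1 : X a = X ω <;> by_cases h2 : Y b = Y ω <;> simp [h1, h2]
        rw [Finset.sum_congr rfl fun ω _ => e ω, ← Finset.sum_filter, ← hS]
        rcases S.eq_empty_or_nonempty with h0 | ⟨ω₀, h0⟩
        · rw [h0, Finset.sum_empty]; positivity
        · have h0' : X a = X ω₀ ∧ Y b = Y ω₀ := by simpa [hS] using h0
          rw [if_pos ((hY _ _ h0'.2).trans (hX _ _ h0'.1).symm)]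
          have hSpos : (0 : ℝ) < S.card := by exact_mod_cast Finset.card_pos.2 ⟨ω₀, h0⟩
          calc ∑ ω ∈ S, 1 / (cellCard W ω * cellCard Z ω : ℝ)
              ≤ ∑ ω ∈ S, 1 / (S.card * cellCard Z a : ℝ) := by
                refine Finset.sum_le_sum fun ω hω => ?_
                have hω' : X a = X ω ∧ Y b = Y ω := by simpa [hS] using hω
                rw [cellCard_congr (hX _ _ hω'.1)] at hz ⊢
                refine one_div_le_one_div_of_le (by positivity) ?_
                refine mul_le_mul_of_nonneg_right ?_ hz.le
                have : S ⊆ Finset.univ.filter fun ω' => W ω' = W ω := by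
                  intro ω' h'
                  have h'' : X a = X ω' ∧ Y b = Y ω' := by simpa [hS] using h'
                  simpa using hW _ _ (h''.1.symm.trans hω'.1) (h''.2.symm.trans hω'.2)
                exact_mod_cast Finset.card_le_card this
            _ = 1 / cellCard Z a := by
                rw [Finset.sum_const, nsmul_eq_mul]; field_simp
    _ = Fintype.card Ω := by
        have : ∀ a, ∑ b, (if Z b = Z a then (1 : ℝ) else 0) / cellCard Z a = 1 := by
          intro a
          have hz : (cellCard Z a : ℝ) ≠ 0 := by exact_mod_cast (cellCard_pos Z a).ne'
          rw [← Finset.sum_div, div_eq_one_iff_eq hz]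
          simp [cellCard]
        simp [this, Finset.card_univ]

/-- Submodularity of entropy. -/
theorem uniformEntropy_submodular {X : Ω → A} {Y : Ω → B} {Z : Ω → C} {W : Ω → D}
    (hW : ∀ ω ω', X ω = X ω' → Y ω = Y ω' → W ω = W ω')
    (hX : ∀ ω ω', X ω = X ω' → Z ω = Z ω') (hY : ∀ ω ω', Y ω = Y ω' → Z ω = Z ω') :
    uniformEntropy W + uniformEntropy Z ≤ uniformEntropy X + uniformEntropy Y := by
  unfold uniformEntropy
  rw [← add_div, ← add_div]
  refine div_le_div_of_nonneg_right ?_ (Nat.cast_nonneg _)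
  rw [← Finset.sum_add_distrib, ← Finset.sum_add_distrib, ← sub_nonpos, ← Finset.sum_sub_distrib]
  have hl : 0 < Real.log 2 := Real.log_pos (by norm_num)
  -- The pointwise bound is log x ≤ x - 1 at the ratio of cell sizes; |Ω| cancels from the
  -- logarithms.
  have key : ∀ ω, Real.logb 2 (Fintype.card Ω / cellCard W ω) +
      Real.logb 2 (Fintype.card Ω / cellCard Z ω) - (Real.logb 2 (Fintype.card Ω / cellCard X ω) +
      Real.logb 2 (Fintype.card Ω / cellCard Y ω)) ≤
      ((cellCard X ω * cellCard Y ω : ℝ) / (cellCard W ω * cellCard Z ω) - 1) / Real.log 2 := by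
    intro ω
    have hx : (0 : ℝ) < cellCard X ω := by exact_mod_cast cellCard_pos X ω
    have hy : (0 : ℝ) < cellCard Y ω := by exact_mod_cast cellCard_pos Y ω
    have hz : (0 : ℝ) < cellCard Z ω := by exact_mod_cast cellCard_pos Z ω
    have hw : (0 : ℝ) < cellCard W ω := by exact_mod_cast cellCard_pos W ω
    have hn : (0 : ℝ) < Fintype.card Ω := by exact_mod_cast Fintype.card_pos_iff.2 ⟨ω⟩
    have := Real.log_le_sub_one_of_pos
      (show 0 < (cellCard X ω * cellCard Y ω : ℝ) / (cellCard W ω * cellCard Z ω) by positivity)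
    refine le_trans (le_of_eq ?_) (div_le_div_of_nonneg_right this hl.le)
    simp only [Real.logb]
    rw [Real.log_div hn.ne' hw.ne', Real.log_div hn.ne' hz.ne', Real.log_div hn.ne' hx.ne',
      Real.log_div hn.ne' hy.ne', Real.log_div (by positivity) (by positivity),
      Real.log_mul hx.ne' hy.ne', Real.log_mul hw.ne' hz.ne']
    ring
  refine (Finset.sum_le_sum fun ω _ => key ω).trans ?_
  rw [← Finset.sum_div, Finset.sum_sub_distrib]
  refine div_nonpos_of_nonpos_of_nonneg ?_ hl.le
  have := sum_cellCard_ratio_le hW hX hY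
  simpa [Finset.card_univ] using this

theorem uniformEntropy_le_add {X : Ω → A} {Y : Ω → B} {W : Ω → D}
    (hW : ∀ ω ω', X ω = X ω' → Y ω = Y ω' → W ω = W ω') :
    uniformEntropy W ≤ uniformEntropy X + uniformEntropy Y := by
  have := uniformEntropy_submodular (Z := fun _ : Ω => ()) hW (fun _ _ _ => rfl)
    (fun _ _ _ => rfl)
  linarith [uniformEntropy_nonneg (fun _ : Ω => ())]

/-- The uniform law maximizes entropy. -/
theorem uniformEntropy_le_logb_card [Fintype A] [Nonempty Ω] (X : Ω → A) :
    uniformEntropy X ≤ Real.logb 2 (Fintype.card A) := by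
  classical
  have hn : (0 : ℝ) < Fintype.card Ω := by exact_mod_cast Fintype.card_pos
  have hA : (0 : ℝ) < Fintype.card A := by
    exact_mod_cast Fintype.card_pos_iff.2 ⟨X (Classical.arbitrary Ω)⟩
  have hl : 0 < Real.log 2 := Real.log_pos (by norm_num)
  rw [uniformEntropy, div_le_iff₀ hn, ← sub_nonpos]
  have e : Real.logb 2 (Fintype.card A) * Fintype.card Ω =
      ∑ _ω : Ω, Real.logb 2 (Fintype.card A) := by simp [Finset.card_univ, mul_comm]
  rw [e, ← Finset.sum_sub_distrib]
  have key : ∀ ω, Real.logb 2 (Fintype.card Ω / cellCard X ω) - Real.logb 2 (Fintype.card A) ≤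
      ((Fintype.card Ω / Fintype.card A : ℝ) * (1 / cellCard X ω) - 1) / Real.log 2 := by
    intro ω
    have hx : (0 : ℝ) < cellCard X ω := by exact_mod_cast cellCard_pos X ω
    have := Real.log_le_sub_one_of_pos
      (show 0 < (Fintype.card Ω / Fintype.card A : ℝ) * (1 / cellCard X ω) by positivity)
    refine le_trans (le_of_eq ?_) (div_le_div_of_nonneg_right this hl.le)
    simp only [Real.logb]
    rw [Real.log_mul (by positivity) (by positivity), Real.log_div hn.ne' hA.ne',
      Real.log_div hn.ne' hx.ne', Real.log_div one_ne_zero hx.ne', Real.log_one]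
    ring
  refine (Finset.sum_le_sum fun ω _ => key ω).trans ?_
  rw [← Finset.sum_div, Finset.sum_sub_distrib, ← Finset.mul_sum]
  refine div_nonpos_of_nonpos_of_nonneg ?_ hl.le
  -- Each nonempty fibre contributes exactly 1, so the sum counts the values attained by `X`.
  have h1 : ∑ ω, 1 / (cellCard X ω : ℝ) ≤ Fintype.card A := by
    rw [← Finset.sum_fiberwise Finset.univ X, ← Finset.card_univ, Finset.card_eq_sum_ones,
      Nat.cast_sum]
    refine Finset.sum_le_sum fun a _ => ?_
    rcases (Finset.univ.filter fun ω => X ω = a).eq_empty_or_nonempty with h0 | ⟨ω₀, h0⟩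
    · rw [h0]; simp
    · have h0' : X ω₀ = a := by simpa using h0
      have : ∀ ω ∈ Finset.univ.filter (fun ω => X ω = a), 1 / (cellCard X ω : ℝ) =
          1 / (Finset.univ.filter fun ω => X ω = a).card := by
        intro ω hω
        have : X ω = a := by simpa using hω
        simp [cellCard, this]
      rw [Finset.sum_congr rfl this, Finset.sum_const, nsmul_eq_mul, mul_one_div]
      simpa using div_self_le_one _
  have h2 : (Fintype.card Ω / Fintype.card A : ℝ) * ∑ ω, 1 / (cellCard X ω : ℝ) ≤
      (Fintype.card Ω / Fintype.card A : ℝ) * Fintype.card A :=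
    mul_le_mul_of_nonneg_left h1 (by positivity)
  rw [div_mul_cancel₀ _ hA.ne'] at h2
  simpa [Finset.card_univ] using h2

/-- The entropy of `X` in terms of the probabilities of its values. -/
theorem uniformEntropy_eq_sum [Nonempty Ω] [Fintype A] [DecidableEq A] (X : Ω → A) :
    uniformEntropy X = ∑ a, Real.negMulLog
      ((Finset.univ.filter fun ω => X ω = a).card / Fintype.card Ω) / Real.log 2 := by
  classical
  have hn : (0 : ℝ) < Fintype.card Ω := by exact_mod_cast Fintype.card_pos
  rw [uniformEntropy, ← Finset.sum_fiberwise Finset.univ X, Finset.sum_div]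
  refine Finset.sum_congr rfl fun a _ => ?_
  have : ∀ ω ∈ Finset.univ.filter (fun ω => X ω = a),
      Real.logb 2 (Fintype.card Ω / cellCard X ω) =
      Real.logb 2 (Fintype.card Ω / (Finset.univ.filter fun ω => X ω = a).card) := by
    intro ω hω
    have : X ω = a := by simpa using hω
    simp [cellCard, this]
  have hlog := Real.log_inv
    ((Fintype.card Ω : ℝ) / (Finset.univ.filter fun ω => X ω = a).card)
  rw [inv_div] at hlog
  rw [Finset.sum_congr rfl this, Finset.sum_const, nsmul_eq_mul, Real.negMulLog, Real.logb, hlog]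
  ring

end UniformEntropy

/-! ## Entropy of discrete laws -/

section DiscreteEntropy

theorem log_two_pos : 0 < Real.log 2 := Real.log_pos (by norm_num)

theorem pmf_toReal_nonneg {A : Type*} (q : PMF A) (a : A) : 0 ≤ (q a).toReal :=
  ENNReal.toReal_nonneg

theorem pmf_toReal_le_one {A : Type*} (q : PMF A) (a : A) : (q a).toReal ≤ 1 := by
  simpa using ENNReal.toReal_mono ENNReal.one_ne_top (q.coe_le_one a)

theorem entropyTerm_nonneg {A : Type*} (q : PMF A) (a : A) :
    0 ≤ Real.negMulLog (q a).toReal / Real.log 2 :=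
  div_nonneg (Real.negMulLog_nonneg (pmf_toReal_nonneg q a) (pmf_toReal_le_one q a))
    log_two_pos.le

theorem entropy_nonneg {A : Type*} (q : PMF A) : 0 ≤ entropy q :=
  tsum_nonneg fun a => entropyTerm_nonneg q a

theorem hasEntropy_entropy {A : Type*} [Finite A] (q : PMF A) : HasEntropy q (entropy q) := by
  cases nonempty_fintype A
  exact (hasSum_fintype _).summable.hasSum

theorem entropy_eq_sum {A : Type*} [Fintype A] (q : PMF A) :
    entropy q = ∑ a, Real.negMulLog (q a).toReal / Real.log 2 :=
  tsum_fintype _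

theorem sum_pmf_toReal {A : Type*} [Fintype A] (q : PMF A) : ∑ a, (q a).toReal = 1 := by
  rw [← ENNReal.toReal_sum fun a _ => q.apply_ne_top a, ← tsum_fintype (L := .unconditional _),
    q.tsum_coe, ENNReal.toReal_one]

theorem map_toReal_eq_sum {A B : Type*} [Fintype A] [DecidableEq B] (q : PMF A) (f : A → B)
    (b : B) : ((q.map f) b).toReal = ∑ a ∈ Finset.univ.filter fun a => f a = b, (q a).toReal := by
  classical
  rw [PMF.map_apply, tsum_fintype, ENNReal.toReal_sum, Finset.sum_filter]
  · refine Finset.sum_congr rfl fun a _ => ?_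
    by_cases h : f a = b
    · simp [h]
    · simp [h, Ne.symm h]
  · intro a _
    split_ifs
    · exact q.apply_ne_top a
    · simp

theorem entropy_le_logb_card {A : Type*} [Fintype A] (q : PMF A) :
    entropy q ≤ Real.logb 2 (Fintype.card A) := by
  have hA : (0 : ℝ) < Fintype.card A := by
    obtain ⟨a, _⟩ := q.support_nonempty
    exact_mod_cast Fintype.card_pos_iff.2 ⟨a⟩
  rw [entropy_eq_sum, ← Finset.sum_div, Real.logb]
  refine div_le_div_of_nonneg_right ?_ log_two_pos.le
  have key : ∀ a, Real.negMulLog (q a).toReal ≤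
      (q a).toReal * Real.log (Fintype.card A) + (1 / Fintype.card A - (q a).toReal) := by
    intro a
    rcases (pmf_toReal_nonneg q a).eq_or_lt with h0 | h0
    · rw [← h0]; simp
    · have := Real.log_le_sub_one_of_pos
        (show 0 < 1 / ((q a).toReal * Fintype.card A) by positivity)
      rw [Real.log_div one_ne_zero (by positivity), Real.log_one,
        Real.log_mul h0.ne' hA.ne'] at this
      have h2 := mul_le_mul_of_nonneg_left this h0.le
      have h3 : (q a).toReal * (1 / ((q a).toReal * Fintype.card A) - 1) =
          1 / Fintype.card A - (q a).toReal := by field_simp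
      rw [Real.negMulLog]
      linarith
  refine (Finset.sum_le_sum fun a _ => key a).trans ?_
  rw [Finset.sum_add_distrib, ← Finset.sum_mul, Finset.sum_sub_distrib, sum_pmf_toReal]
  simp [Finset.card_univ, hA.ne']

theorem map_apply_of_injective {A B : Type*} (q : PMF A) {f : A → B}
    (hf : Function.Injective f) (a : A) : (q.map f) (f a) = q a := by
  classical
  rw [PMF.map_apply, tsum_eq_single a]
  · simp
  · intro a' h
    simp [hf.eq_iff, Ne.symm h]

theorem HasEntropy.map_injective {A B : Type*} {q : PMF A} {v : ℝ} (h : HasEntropy q v)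
    {f : A → B} (hf : Function.Injective f) : HasEntropy (q.map f) v := by
  classical
  unfold HasEntropy at h ⊢
  rw [← hf.hasSum_iff]
  · convert h using 3 with a
    rw [Function.comp_apply, map_apply_of_injective q hf]
  · intro b hb
    have : (q.map f) b = 0 := by
      rw [PMF.apply_eq_zero_iff, PMF.support_map]
      rintro ⟨a, _, rfl⟩
      exact hb ⟨a, rfl⟩
    simp [this]

theorem hasEntropy_of_subsingleton {A : Type*} [Subsingleton A] (q : PMF A) :
    HasEntropy q 0 := by
  obtain ⟨a, _⟩ := q.support_nonempty
  have : Unique A := ⟨⟨a⟩, fun b => Subsingleton.elim _ _⟩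
  have h1 : q default = 1 := by
    have := q.tsum_coe
    rwa [tsum_fintype, Fintype.sum_unique] at this
  have := hasSum_unique (fun a => Real.negMulLog (q a).toReal / Real.log 2)
  simpa [HasEntropy, h1] using this

theorem hasEntropy_uniform_map {Ω A : Type*} [Fintype Ω] [Nonempty Ω] [Finite A] (X : Ω → A) :
    HasEntropy ((PMF.uniformOfFintype Ω).map X) (uniformEntropy X) := by
  classical
  cases nonempty_fintype A
  rw [uniformEntropy_eq_sum]
  have := hasSum_fintype
    (fun a => Real.negMulLog (((PMF.uniformOfFintype Ω).map X) a).toReal / Real.log 2)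
  unfold HasEntropy
  convert this using 5 with a
  rw [map_toReal_eq_sum]
  simp [div_eq_mul_inv]

end DiscreteEntropy

/-! ## Entropic functions -/

section Entropic

variable {N : ℕ}

theorem isEntropic_of_hasEntropy {Ω : Type*} (q : PMF Ω) {A : Fin N → Type*}
    [∀ j, Countable (A j)] (X : ∀ j, Ω → A j) {g : Finset (Fin N) → ℝ}
    (h : ∀ α : Finset (Fin N), HasEntropy (q.map fun ω (j : α) => X j ω) (g α)) :
    IsEntropic g := by
  choose e he using fun j => exists_injective_nat (A j)
  refine ⟨q.map fun ω j => e j (X j ω), fun α => ?_⟩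
  have h1 := (h α).map_injective (f := fun (y : ∀ j : α, A j) (j : α) => e j (y j)) (by
    intro y y' hy
    funext j
    exact he j (congrFun hy j))
  rw [PMF.map_comp] at h1 ⊢
  exact h1

theorem isEntropic_uniformEntropy {Ω : Type*} [Fintype Ω] [Nonempty Ω] {A : Fin N → Type*}
    [∀ j, Finite (A j)] (X : ∀ j, Ω → A j) :
    IsEntropic fun α : Finset (Fin N) => uniformEntropy fun ω (j : α) => X j ω :=
  isEntropic_of_hasEntropy (PMF.uniformOfFintype Ω) X fun _ => hasEntropy_uniform_map _

theorem isAlmostEntropic_iff_mem_closure {h : Finset (Fin N) → ℝ} :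
    IsAlmostEntropic h ↔ h ∈ closure {h : Finset (Fin N) → ℝ | IsEntropic h} :=
  (mem_closure_iff_seq_limit (s := {h : Finset (Fin N) → ℝ | IsEntropic h})).symm

theorem IsEntropic.apply_empty {h : Finset (Fin N) → ℝ} (hh : IsEntropic h) : h ∅ = 0 := by
  obtain ⟨p, hp⟩ := hh
  exact (hp ∅).unique (hasEntropy_of_subsingleton _)

theorem IsAlmostEntropic.apply_empty {h : Finset (Fin N) → ℝ} (hh : IsAlmostEntropic h) :
    h ∅ = 0 := by
  obtain ⟨f, hf, hlim⟩ := hh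
  have := (tendsto_pi_nhds.1 hlim) ∅
  simp only [(hf _).apply_empty] at this
  exact (tendsto_const_nhds_iff.1 this).symm

theorem isAlmostEntropic_of_forall_approx {h : Finset (Fin N) → ℝ}
    (H : ∀ ε > 0, ∃ g, IsAlmostEntropic g ∧ ∀ α, |g α - h α| ≤ ε) : IsAlmostEntropic h := by
  rw [isAlmostEntropic_iff_mem_closure, ← closure_closure, Metric.mem_closure_iff]
  intro ε hε
  obtain ⟨g, hg, hgh⟩ := H (ε / 2) (by positivity)
  refine ⟨g, isAlmostEntropic_iff_mem_closure.1 hg, ?_⟩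
  refine lt_of_le_of_lt ((dist_pi_le_iff (by positivity)).2 fun α => ?_) (half_lt_self hε)
  rw [dist_comm, Real.dist_eq]
  exact hgh α

theorem IsEntropic.isAlmostEntropic {h : Finset (Fin N) → ℝ} (hh : IsEntropic h) :
    IsAlmostEntropic h :=
  isAlmostEntropic_iff_mem_closure.2 (subset_closure hh)

end Entropic

/-! ## Asymptotics of multinomial coefficients -/

section Multinomial

-- With the next lemma, a weak Stirling formula: the error O(log n) is negligible after division by
-- the word length.
open Nat in
theorem mul_log_sub_le_log_factorial (n : ℕ) :
    n * Real.log n - n ≤ Real.log (n ! : ℝ) := by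
  induction n with
  | zero => simp
  | succ n ih =>
    rcases n.eq_zero_or_pos with rfl | hn
    · simp
    · have hn' : (0 : ℝ) < n := by exact_mod_cast hn
      have h1 : Real.log ((n + 1)! : ℝ) = Real.log (n + 1) + Real.log (n ! : ℝ) := by
        rw [Nat.factorial_succ, Nat.cast_mul, Real.log_mul (by positivity) (by positivity)]
        push_cast; rfl
      have h2 : Real.log ((n + 1 : ℝ) / n) ≤ (n + 1 : ℝ) / n - 1 :=
        Real.log_le_sub_one_of_pos (by positivity)
      rw [Real.log_div (by positivity) hn'.ne'] at h2
      have h3 := mul_le_mul_of_nonneg_left h2 hn'.le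
      have h4 : (n : ℝ) * ((n + 1 : ℝ) / n - 1) = 1 := by field_simp; ring
      rw [h1]
      push_cast
      linarith

open Nat in
theorem log_factorial_le (n : ℕ) :
    Real.log (n ! : ℝ) ≤ n * Real.log n - n + Real.log n + 1 := by
  induction n with
  | zero => simp
  | succ n ih =>
    rcases n.eq_zero_or_pos with rfl | hn
    · simp
    · have hn' : (0 : ℝ) < n := by exact_mod_cast hn
      have h1 : Real.log ((n + 1)! : ℝ) = Real.log (n + 1) + Real.log (n ! : ℝ) := by
        rw [Nat.factorial_succ, Nat.cast_mul, Real.log_mul (by positivity) (by positivity)]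
        push_cast; rfl
      have h2 : 1 - ((n + 1 : ℝ) / n)⁻¹ ≤ Real.log ((n + 1 : ℝ) / n) :=
        Real.one_sub_inv_le_log_of_pos (by positivity)
      rw [Real.log_div (by positivity) hn'.ne'] at h2
      have h3 := mul_le_mul_of_nonneg_left h2 (show (0 : ℝ) ≤ n + 1 by positivity)
      have h4 : (n + 1 : ℝ) * (1 - ((n + 1 : ℝ) / n)⁻¹) = 1 := by field_simp; ring
      rw [h1]
      push_cast
      linarith

/-- Makes log k(t) / t → 0 follow from convergence of k(t) / t alone, without k(t) → ∞. -/
theorem log_natCast_le_two_mul_sqrt (n : ℕ) : Real.log n ≤ 2 * √(n : ℝ) := by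
  rcases n.eq_zero_or_pos with rfl | hn
  · simp
  · have hn' : (0 : ℝ) < n := by exact_mod_cast hn
    have := Real.log_le_sub_one_of_pos (Real.sqrt_pos.2 hn')
    rw [Real.log_sqrt hn'.le] at this
    linarith

-- By Stirling the numerator is about k log (k/t). Comparing with log t instead of log k keeps the
-- limit valid at c = 0, and the log t terms cancel in multinomial coefficients.
open Nat in
theorem tendsto_log_factorial_div {k : ℕ → ℕ} {c : ℝ}
    (hk : Tendsto (fun t : ℕ => (k t : ℝ) / t) atTop (𝓝 c)) :
    Tendsto (fun t : ℕ => (Real.log ((k t)! : ℝ) - k t * Real.log t + k t) / t) atTop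
      (𝓝 (-Real.negMulLog c)) := by
  have hinv : Tendsto (fun t : ℕ => 1 / (t : ℝ)) atTop (𝓝 0) := tendsto_one_div_atTop_nhds_zero_nat
  have hsq : Tendsto (fun t : ℕ => 2 * (√((k t : ℝ) / t) * √(1 / (t : ℝ))) + 1 / (t : ℝ)) atTop
      (𝓝 0) := by
    have h1 := (Real.continuous_sqrt.tendsto _).comp hk
    have h2 := (Real.continuous_sqrt.tendsto _).comp hinv
    have := ((h1.mul h2).const_mul 2).add hinv
    simpa using this
  have herr : Tendsto (fun t : ℕ =>
      (Real.log ((k t)! : ℝ) - (k t * Real.log (k t) - k t)) / t) atTop (𝓝 0) := by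
    refine tendsto_of_tendsto_of_tendsto_of_le_of_le tendsto_const_nhds hsq ?_ ?_
    · intro t
      exact div_nonneg (by linarith [mul_log_sub_le_log_factorial (k t)]) (Nat.cast_nonneg _)
    · intro t
      have h1 := log_factorial_le (k t)
      have h2 := log_natCast_le_two_mul_sqrt (k t)
      have h3 : √((k t : ℝ) / t) * √(1 / (t : ℝ)) = √(k t : ℝ) / t := by
        rw [← Real.sqrt_mul (by positivity), mul_one_div, div_div,
          Real.sqrt_div (by positivity), Real.sqrt_mul_self (by positivity)]
      simp only [h3]
      rw [← mul_div_assoc, ← add_div]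
      exact div_le_div_of_nonneg_right (by linarith) (Nat.cast_nonneg _)
  have hmain := (Real.continuous_negMulLog.tendsto c).comp hk
  have := herr.sub hmain
  rw [zero_sub] at this
  refine this.congr' ?_
  filter_upwards [eventually_gt_atTop 0] with t ht
  have ht' : (0 : ℝ) < t := by exact_mod_cast ht
  simp only [Function.comp_apply, Real.negMulLog]
  rcases (k t).eq_zero_or_pos with h0 | h0
  · simp [h0]
  · have h0' : (0 : ℝ) < k t := by exact_mod_cast h0
    rw [Real.log_div h0'.ne' ht'.ne']
    field_simp
    ring

open Nat in
theorem tendsto_log_multinomial_div {B : Type*} [Fintype B] {k : ℕ → B → ℕ} {c : B → ℝ}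
    (hk : ∀ b, Tendsto (fun t : ℕ => (k t b : ℝ) / t) atTop (𝓝 (c b))) (hc : ∑ b, c b = 1) :
    Tendsto (fun t : ℕ => (Real.log ((∑ b, k t b)! : ℝ) - ∑ b, Real.log ((k t b)! : ℝ)) / t)
      atTop (𝓝 (∑ b, Real.negMulLog (c b))) := by
  have htot : Tendsto (fun t : ℕ => ((∑ b, k t b : ℕ) : ℝ) / t) atTop (𝓝 1) := by
    rw [← hc]
    refine (tendsto_finsetSum Finset.univ fun b _ => hk b).congr fun t => ?_
    rw [Nat.cast_sum, Finset.sum_div]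
  have h1 := tendsto_log_factorial_div htot
  have h2 := tendsto_finsetSum Finset.univ fun b _ => tendsto_log_factorial_div (hk b)
  have := h1.sub h2
  rw [Real.negMulLog_one, neg_zero, zero_sub, Finset.sum_neg_distrib, neg_neg] at this
  refine this.congr fun t => ?_
  rw [← Finset.sum_div, ← sub_div, Finset.sum_add_distrib, Finset.sum_sub_distrib, Nat.cast_sum,
    ← Finset.sum_mul]
  ring

end Multinomial

/-! ## Subgroups of permutations preserving a function -/

section Stabilizer

/-- The permutations that preserve `Y`. -/
def permStabilizer {ι B : Type*} (Y : ι → B) : Subgroup (Equiv.Perm ι) where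
  carrier := {g | Y ∘ g = Y}
  one_mem' := rfl
  mul_mem' := by
    intro a b ha hb
    have ha' : Y ∘ a = Y := ha
    have hb' : Y ∘ b = Y := hb
    change Y ∘ (a ∘ b) = Y
    rw [← Function.comp_assoc, ha', hb']
  inv_mem' := by
    intro a ha
    have ha' : Y ∘ a = Y := ha
    funext i
    have := congrFun ha' (a⁻¹ i)
    simpa using this.symm

theorem mem_permStabilizer {ι B : Type*} {Y : ι → B} {g : Equiv.Perm ι} :
    g ∈ permStabilizer Y ↔ Y ∘ g = Y :=
  Iff.rfl

/-- This is why one group serves all α at once: joint variables correspond to intersections of the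
coordinate stabilizers. -/
theorem permStabilizer_pi {ι J : Type*} {B : J → Type*} (s : Finset J) (Y : ι → ∀ j, B j) :
    permStabilizer (fun i (j : s) => Y i j) = ⨅ j ∈ s, permStabilizer fun i => Y i j := by
  ext g
  simp only [Subgroup.mem_iInf, mem_permStabilizer, funext_iff, Function.comp_apply,
    Subtype.forall]
  exact ⟨fun h j hj i => h i j hj, fun h i j hj => h j hj i⟩

-- The index is the size of the orbit of the word `Y`, a multinomial coefficient, because the
-- stabilizer is a product of symmetric groups on the fibres.
open Nat in
theorem log_index_permStabilizer {ι B : Type*} [Fintype ι] [Fintype B] [DecidableEq B]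
    (Y : ι → B) :
    Real.log ((permStabilizer Y).index : ℝ) = Real.log ((Fintype.card ι)! : ℝ) -
      ∑ b, Real.log ((Fintype.card {i // Y i = b})! : ℝ) := by
  classical
  have h1 := (permStabilizer Y).card_mul_index
  have h2 : Nat.card (permStabilizer Y) = ∏ b, (Fintype.card {i // Y i = b})! := by
    rw [← DomMulAct.stabilizer_card Y, ← Nat.card_eq_fintype_card]
    rfl
  rw [h2, Nat.card_perm, Nat.card_eq_fintype_card] at h1
  have h3 : (permStabilizer Y).index ≠ 0 := Subgroup.index_ne_zero_of_finite
  rw [← h1, Nat.cast_mul, Nat.cast_prod, Real.log_mul, Real.log_prod]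
  · ring
  · intro b _; positivity
  · exact Finset.prod_ne_zero_iff.2 fun b _ => by positivity
  · exact_mod_cast h3

end Stabilizer

/-! ## Approximation of entropic functions by indices of subgroups -/

section GroupApproximation

theorem card_fiber_sigma {A B : Type*} [Fintype A] [DecidableEq B] (k : A → ℕ) (X : A → B)
    (b : B) : Fintype.card {i : Σ a, Fin (k a) // X i.1 = b} =
      ∑ a ∈ Finset.univ.filter (fun a => X a = b), k a := by
  classical
  rw [Fintype.card_subtype, Finset.sum_filter]
  have : (Finset.univ.filter fun i : Σ a, Fin (k a) => X i.1 = b).card =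
      ∑ i : Σ a, Fin (k a), if X i.1 = b then 1 else 0 := by simp
  rw [this, Fintype.sum_sigma]
  refine Finset.sum_congr rfl fun a _ => ?_
  by_cases h : X a = b <;> simp [h]

/-- Permutations of a word of length about `t` in which each letter `a` occurs `⌊t p(a)⌋` times:
the stabilizer of a function of the letters has index about `2 ^ (t H)`. -/
theorem tendsto_logb_index_div {A B : Type*} [Fintype A] [Fintype B] (p : PMF A) (X : A → B) :
    Tendsto (fun t : ℕ => Real.logb 2 (permStabilizer
      (fun i : Σ a, Fin ⌊(p a).toReal * t⌋₊ => X i.1)).index / t) atTop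
      (𝓝 (entropy (p.map X))) := by
  classical
  -- Because of the floors the counts sum only approximately to t; the multinomial asymptotics need
  -- no more than convergence of the frequencies.
  set k : ℕ → B → ℕ := fun t b =>
    ∑ a ∈ Finset.univ.filter (fun a => X a = b), ⌊(p a).toReal * t⌋₊ with hk
  have h1 : ∀ b, Tendsto (fun t : ℕ => (k t b : ℝ) / t) atTop
      (𝓝 ((p.map X) b).toReal) := by
    intro b
    rw [map_toReal_eq_sum]
    have := tendsto_finsetSum (Finset.univ.filter (fun a => X a = b)) fun a _ =>
      (tendsto_nat_floor_mul_div_atTop (R := ℝ) (pmf_toReal_nonneg p a)).comp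
        tendsto_natCast_atTop_atTop
    refine this.congr fun t => ?_
    simp only [hk, Nat.cast_sum, Finset.sum_div, Function.comp_apply]
  have h2 := (tendsto_log_multinomial_div h1 (sum_pmf_toReal _)).div_const (Real.log 2)
  rw [entropy_eq_sum, ← Finset.sum_div]
  refine h2.congr fun t => ?_
  have hcard : Fintype.card (Σ a, Fin ⌊(p a).toReal * t⌋₊) = ∑ b, k t b := by
    rw [Fintype.card_sigma]
    simp only [Fintype.card_fin]
    exact (Finset.sum_fiberwise Finset.univ X _).symm
  have hfib : ∀ b, Fintype.card {i : Σ a, Fin ⌊(p a).toReal * t⌋₊ // X i.1 = b} = k t b :=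
    fun b => card_fiber_sigma _ X b
  rw [Real.logb, log_index_permStabilizer, hcard]
  simp only [hfib]
  ring

/-- The scale r is the parameter t of the words, which can be taken beyond any `R`; the scaling
argument later needs r large. -/
theorem exists_subgroups_of_pmf {N M : ℕ} (p : PMF (Fin N → Fin M)) {ε : ℝ} (hε : 0 < ε)
    (R : ℝ) :
    ∃ (G : Type) (_ : Group G) (_ : Finite G) (K : Fin N → Subgroup G) (r : ℝ), R ≤ r ∧ 0 < r ∧
      ∀ α : Finset (Fin N), |Real.logb 2 (⨅ j ∈ α, K j).index / r -
        entropy (p.map fun x (j : α) => x j)| ≤ ε := by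
  have h1 : ∀ α : Finset (Fin N), ∀ᶠ t : ℕ in atTop, |Real.logb 2 (permStabilizer
      (fun i : Σ a, Fin ⌊(p a).toReal * t⌋₊ => fun j : α => i.1 j)).index / t -
        entropy (p.map fun x (j : α) => x j)| < ε := fun α => by
    have := Metric.tendsto_nhds.1 (tendsto_logb_index_div p fun x (j : α) => x j) ε hε
    simpa only [Real.dist_eq] using this
  obtain ⟨t, ht, htR, ht0⟩ := ((eventually_all.2 h1).and
    ((tendsto_natCast_atTop_atTop.eventually_ge_atTop R).and (eventually_gt_atTop 0))).exists
  refine ⟨Equiv.Perm (Σ a, Fin ⌊(p a).toReal * t⌋₊), inferInstance, inferInstance,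
    fun j => permStabilizer fun i => i.1 j, t, htR, by exact_mod_cast ht0, fun α => ?_⟩
  have := (ht α).le
  rwa [permStabilizer_pi α (fun i : Σ a, Fin ⌊(p a).toReal * t⌋₊ => i.1)] at this

end GroupApproximation

/-! ## Truncation to a finite alphabet -/

section Truncation

/-- A function of a discrete variable has at most the entropy of the variable. -/
theorem HasEntropy.entropy_map_le {A B : Type*} [Fintype B] {q : PMF A} {v : ℝ}
    (h : HasEntropy q v) (g : A → B) : entropy (q.map g) ≤ v := by
  classical
  have hq : Summable fun a => (q a).toReal := ENNReal.summable_toReal (by simp [q.tsum_coe])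
  have hn : Summable fun a => Real.negMulLog (q a).toReal / Real.log 2 := h.summable
  have hind : ∀ (φ : A → ℝ), Summable φ → ∀ b, Summable fun a => if g a = b then φ a else 0 := by
    intro φ hφ b
    refine (hφ.indicator {a | g a = b}).congr fun a => ?_
    simp [Set.indicator_apply]
  have hmap : ∀ b, ((q.map g) b).toReal = ∑' a, if g a = b then (q a).toReal else 0 := by
    intro b
    rw [PMF.map_apply, ENNReal.tsum_toReal_eq]
    · refine tsum_congr fun a => ?_
      by_cases hb : g a = b
      · simp [hb]
      · simp [hb, Ne.symm hb]
    · intro a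
      split_ifs
      · exact q.apply_ne_top a
      · simp
  -- The mass Q of a fibre dominates each mass p in it, so -Q log Q = ∑ p(-log Q) ≤ ∑ p(-log p).
  have key : ∀ b, Real.negMulLog ((q.map g) b).toReal / Real.log 2 ≤
      ∑' a, if g a = b then Real.negMulLog (q a).toReal / Real.log 2 else 0 := by
    intro b
    set Q := ((q.map g) b).toReal with hQ
    have e : Real.negMulLog Q / Real.log 2 =
        ∑' a, (if g a = b then (q a).toReal else 0) * (-Real.log Q / Real.log 2) := by
      rw [tsum_mul_right, ← hmap, ← hQ, Real.negMulLog]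
      ring
    rw [e]
    refine ((hind _ hq b).mul_right _).tsum_le_tsum (fun a => ?_) (hind _ hn b)
    by_cases hb : g a = b
    · simp only [hb, if_true]
      rw [← mul_div_assoc]
      refine div_le_div_of_nonneg_right ?_ log_two_pos.le
      rcases (pmf_toReal_nonneg q a).eq_or_lt with h0 | h0
      · simp [← h0]
      · have hle : (q a).toReal ≤ Q := by
          rw [hQ, hmap b]
          have := (hind _ hq b).le_tsum a (fun a' _ => by
            split_ifs
            · exact pmf_toReal_nonneg q a'
            · exact le_rfl)
          simpa [hb] using this
        have := Real.log_le_log h0 hle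
        rw [Real.negMulLog]
        nlinarith
    · simp [hb]
  rw [entropy_eq_sum]
  refine (Finset.sum_le_sum fun b _ => key b).trans (le_of_eq ?_)
  rw [← Summable.tsum_finsetSum fun b _ => hind _ hn b, ← h.tsum_eq]
  exact tsum_congr fun a => by simp

/-- Truncation of a natural number at `M`. -/
def truncate (M x : ℕ) : Fin (M + 1) := ⟨min x M, by omega⟩

/-- Sandwich: truncation keeps the atoms of the box [0, M)^J intact, so its entropy is at least the
partial sum over the box, and it is at most `v` as the entropy of a function. -/
theorem tendsto_entropy_truncate {J : Type*} [Fintype J] {q : PMF (J → ℕ)} {v : ℝ}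
    (h : HasEntropy q v) :
    Tendsto (fun M : ℕ => entropy (q.map fun x j => truncate M (x j))) atTop (𝓝 v) := by
  classical
  set S : ℕ → Finset (J → ℕ) := fun M => Fintype.piFinset fun _ => Finset.range M with hS
  have hSlim : Tendsto S atTop atTop := by
    refine tendsto_atTop_finset_of_monotone ?_ fun x => ?_
    · intro M M' hM x hx
      simp only [hS, Fintype.mem_piFinset, Finset.mem_range] at hx ⊢
      exact fun j => (hx j).trans_le hM
    -- Any bound strictly above every coordinate of `x` would do.
    · refine ⟨∑ j, (x j + 1), ?_⟩
      simp only [hS, Fintype.mem_piFinset, Finset.mem_range]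
      intro j
      have := Finset.single_le_sum (f := fun j => x j + 1) (fun _ _ => Nat.zero_le _)
        (Finset.mem_univ j)
      omega
  refine tendsto_of_tendsto_of_tendsto_of_le_of_le (h.comp hSlim) tendsto_const_nhds
    (fun M => ?_) fun M => h.entropy_map_le _
  set τ : (J → ℕ) → J → Fin (M + 1) := fun x j => truncate M (x j) with hτ
  have hinj : ∀ x ∈ S M, ∀ y, τ x = τ y → x = y := by
    intro x hx y hxy
    simp only [hS, Fintype.mem_piFinset, Finset.mem_range] at hx
    funext j
    have h1 := congrArg Fin.val (congrFun hxy j)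
    simp only [hτ, truncate] at h1
    have := hx j
    omega
  -- Overflowing coordinates are sent to the value M, which no box point uses, so the fibre over `τ
  -- x` is only x.
  have hval : ∀ x ∈ S M, (q.map τ) (τ x) = q x := by
    intro x hx
    rw [PMF.map_apply, tsum_eq_single x]
    · simp
    · intro y hy
      rw [if_neg]
      exact fun e => hy (hinj x hx y e).symm
  have hsum : ∑ x ∈ S M, Real.negMulLog (q x).toReal / Real.log 2 =
      ∑ y ∈ (S M).image τ, Real.negMulLog ((q.map τ) y).toReal / Real.log 2 := by
    rw [Finset.sum_image fun x hx y _ e => hinj x hx y e]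
    exact Finset.sum_congr rfl fun x hx => by rw [hval x hx]
  simp only [Function.comp_apply]
  rw [hsum, entropy_eq_sum]
  exact Finset.sum_le_sum_of_subset_of_nonneg (Finset.subset_univ _)
    fun y _ _ => entropyTerm_nonneg _ y

/-- Every entropic function is approximated by normalized logarithms of indices of subgroups of
finite groups. -/
theorem IsEntropic.exists_subgroups {N : ℕ} {f : Finset (Fin N) → ℝ} (hf : IsEntropic f)
    {ε : ℝ} (hε : 0 < ε) (R : ℝ) :
    ∃ (G : Type) (_ : Group G) (_ : Finite G) (K : Fin N → Subgroup G) (r : ℝ), R ≤ r ∧ 0 < r ∧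
      ∀ α : Finset (Fin N), |Real.logb 2 (⨅ j ∈ α, K j).index / r - f α| ≤ ε := by
  obtain ⟨p, hp⟩ := hf
  have h1 : ∀ α : Finset (Fin N), ∀ᶠ M : ℕ in atTop,
      |entropy ((p.map fun x (j : α) => x j).map fun x j => truncate M (x j)) - f α| < ε / 2 :=
    fun α => by
      have := Metric.tendsto_nhds.1 (tendsto_entropy_truncate (hp α)) (ε / 2) (by positivity)
      simpa only [Real.dist_eq] using this
  obtain ⟨M, hM⟩ := (eventually_all.2 h1).exists
  obtain ⟨G, hG, hfin, K, r, hr, hr0, hK⟩ := exists_subgroups_of_pmf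
    (p.map fun x j => truncate M (x j)) (ε := ε / 2) (by positivity) R
  refine ⟨G, hG, hfin, K, r, hr, hr0, fun α => ?_⟩
  have e1 := hK α
  have e2 := (hM α).le
  have e3 : ((p.map fun x (j : α) => x j).map fun x j => truncate M (x j)) =
      ((p.map fun x j => truncate M (x j)).map fun x (j : α) => x j) := by
    rw [PMF.map_comp, PMF.map_comp]; rfl
  rw [e3] at e2
  have := abs_sub_le (Real.logb 2 (⨅ j ∈ α, K j).index / r)
    (entropy ((p.map fun x j => truncate M (x j)).map fun x (j : α) => x j)) (f α)
  linarith

theorem IsAlmostEntropic.exists_subgroups {N : ℕ} {f : Finset (Fin N) → ℝ}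
    (hf : IsAlmostEntropic f) {ε : ℝ} (hε : 0 < ε) :
    ∃ (G : Type) (_ : Group G) (_ : Finite G) (K : Fin N → Subgroup G) (r : ℝ), 0 < r ∧
      ∀ α : Finset (Fin N), |Real.logb 2 (⨅ j ∈ α, K j).index / r - f α| ≤ ε := by
  rw [isAlmostEntropic_iff_mem_closure, Metric.mem_closure_iff] at hf
  obtain ⟨g, hg, hgf⟩ := hf (ε / 2) (by positivity)
  obtain ⟨G, hG, hfin, K, r, -, hr0, hK⟩ :=
    IsEntropic.exists_subgroups hg (show 0 < ε / 2 by positivity) 0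
  refine ⟨G, hG, hfin, K, r, hr0, fun α => ?_⟩
  have e1 := hK α
  have e2 := (dist_le_pi_dist f g α).trans hgf.le
  rw [Real.dist_eq, abs_sub_comm] at e2
  have := abs_sub_le (Real.logb 2 (⨅ j ∈ α, K j).index / r) (g α) (f α)
  linarith

end Truncation

/-! ## Positive multiples of entropic functions -/

section Scaling

variable {G : Type} [Group G]

open Classical in
theorem card_fiber_quotient_mk [Fintype G] (H : Subgroup G) (y : G ⧸ H) :
    ((Finset.univ.filter fun g : G => (g : G ⧸ H) = y).card : ℝ) = Nat.card G / H.index := by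
  have h1 := QuotientGroup.card_preimage_mk H {y}
  have h2 := H.card_mul_index
  have h3 : H.index ≠ 0 := Subgroup.index_ne_zero_of_finite
  rw [show Nat.card ({y} : Set (G ⧸ H)) = 1 by simp, mul_one] at h1
  rw [eq_div_iff (by exact_mod_cast h3), ← h2, ← h1, Nat.cast_mul, Nat.card_eq_fintype_card,
    Fintype.card_subtype]
  congr 3
  ext g
  simp

/-- With probability `p` uniform on `G`, otherwise a constant. -/
noncomputable def erasedUniform (G : Type) [Fintype G] [Nonempty G] (p : ℝ) (h0 : 0 ≤ p)
    (h1 : p ≤ 1) : PMF (Option G) :=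
  PMF.ofFintype (fun o => o.elim (ENNReal.ofReal (1 - p))
    fun _ => ENNReal.ofReal (p / Fintype.card G)) (by
    have hG : (0 : ℝ) < Fintype.card G := by exact_mod_cast Fintype.card_pos
    rw [Fintype.sum_option]
    simp only [Option.elim, Finset.sum_const, Finset.card_univ]
    rw [← ENNReal.ofReal_nsmul, ← ENNReal.ofReal_add (by linarith) (by positivity), nsmul_eq_mul,
      mul_div_cancel₀ _ hG.ne']
    simp)

/-- Chain rule: the erasure flag costs the binary entropy of p, and given no erasure the coset is
uniform. -/
theorem hasEntropy_erasedUniform_quotient [Fintype G] (H : Subgroup G) {p : ℝ} (h0 : 0 ≤ p)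
    (h1 : p ≤ 1) :
    HasEntropy ((erasedUniform G p h0 h1).map (Option.map ((↑) : G → G ⧸ H)))
      (Real.binEntropy p / Real.log 2 + p * Real.logb 2 H.index) := by
  classical
  have hG : (0 : ℝ) < Fintype.card G := by exact_mod_cast Fintype.card_pos
  have hi : (0 : ℝ) < H.index := by
    exact_mod_cast Nat.pos_of_ne_zero Subgroup.index_ne_zero_of_finite
  have hfin : Finite (G ⧸ H) := inferInstance
  cases nonempty_fintype (G ⧸ H)
  have hnone : (((erasedUniform G p h0 h1).map (Option.map ((↑) : G → G ⧸ H))) none).toReal =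
      1 - p := by
    rw [map_toReal_eq_sum]
    have : (Finset.univ.filter fun o : Option G => Option.map ((↑) : G → G ⧸ H) o = none) =
        {none} := by
      ext o; simp
    rw [this, Finset.sum_singleton]
    simp [erasedUniform, h1]
  have hsome : ∀ y : G ⧸ H,
      (((erasedUniform G p h0 h1).map (Option.map ((↑) : G → G ⧸ H))) (some y)).toReal =
      p / H.index := by
    intro y
    rw [map_toReal_eq_sum, Finset.sum_filter, Fintype.sum_option]
    have hp : 0 ≤ p / Fintype.card G := by positivity
    simp only [Option.map_none, reduceCtorEq, if_false, zero_add, Option.map_some,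
      Option.some.injEq, erasedUniform, PMF.ofFintype_apply, Option.elim,
      ENNReal.toReal_ofReal hp]
    rw [← Finset.sum_filter, Finset.sum_const, nsmul_eq_mul, card_fiber_quotient_mk,
      Nat.card_eq_fintype_card]
    field_simp
  have := hasEntropy_entropy ((erasedUniform G p h0 h1).map (Option.map ((↑) : G → G ⧸ H)))
  convert this using 1
  rw [entropy_eq_sum, Fintype.sum_option, hnone]
  simp only [hsome, Finset.sum_const, Finset.card_univ, nsmul_eq_mul]
  rw [← Nat.card_eq_fintype_card]
  change _ = _ + (H.index : ℝ) * _
  rw [Real.binEntropy_eq_negMulLog_add_negMulLog_one_sub]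
  simp only [Real.negMulLog, Real.logb]
  rcases h0.eq_or_lt with h | h
  · simp [← h]
  · rw [Real.log_div h.ne' hi.ne']
    field_simp
    ring

/-- A coset of an intersection is determined by the cosets of the individual subgroups. -/
theorem quotient_iInf_mk_eq_iff {J : Type*} (s : Finset J) (K : J → Subgroup G) (g g' : G) :
    (g : G ⧸ (⨅ j ∈ s, K j)) = g' ↔ ∀ j ∈ s, (g : G ⧸ K j) = g' := by
  simp only [QuotientGroup.eq, Subgroup.mem_iInf]

/-- One erasure flag is shared by all variables, so the binary entropy is paid once for each
nonempty α, whatever its size. -/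
theorem isEntropic_erasedUniform {N : ℕ} [Finite G] (K : Fin N → Subgroup G) {p : ℝ}
    (h0 : 0 ≤ p)
    (h1 : p ≤ 1) :
    IsEntropic fun α : Finset (Fin N) => if α = ∅ then 0 else
      Real.binEntropy p / Real.log 2 + p * Real.logb 2 (⨅ j ∈ α, K j).index := by
  classical
  cases nonempty_fintype G
  refine isEntropic_of_hasEntropy (erasedUniform G p h0 h1)
    (fun j => Option.map ((↑) : G → G ⧸ K j)) fun α => ?_
  split_ifs with hα
  · subst hα
    exact hasEntropy_of_subsingleton _
  · obtain ⟨j₀, hj₀⟩ := Finset.nonempty_iff_ne_empty.2 hα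
    have hle : ∀ j ∈ α, (⨅ j ∈ α, K j) ≤ K j := fun j hj => iInf₂_le j hj
    let proj : ∀ j ∈ α, G ⧸ (⨅ j ∈ α, K j) → G ⧸ K j := fun j hj =>
      Quotient.map' id fun a b hab => by
        rw [QuotientGroup.leftRel_apply] at hab ⊢
        exact hle j hj hab
    have hproj : ∀ j (hj : j ∈ α) (g : G), proj j hj (g : G ⧸ (⨅ j ∈ α, K j)) = (g : G ⧸ K j) :=
      fun j hj g => rfl
    have hinj : Function.Injective fun (y : Option (G ⧸ (⨅ j ∈ α, K j))) (j : α) =>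
        y.map (proj j j.2) := by
      intro y y' hy
      have hy' := fun (j : α) => congrFun hy j
      rcases y with _ | y <;> rcases y' with _ | y'
      · rfl
      · simpa using hy' ⟨j₀, hj₀⟩
      · simpa using hy' ⟨j₀, hj₀⟩
      · induction y using QuotientGroup.induction_on with
        | H g =>
          induction y' using QuotientGroup.induction_on with
          | H g' =>
            rw [(quotient_iInf_mk_eq_iff α K g g').2]
            intro j hj
            simpa [hproj] using hy' ⟨j, hj⟩
    have := (hasEntropy_erasedUniform_quotient (⨅ j ∈ α, K j) h0 h1).map_injective hinj
    rw [PMF.map_comp] at this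
    convert this using 2
    funext ω j
    rcases ω with _ | g
    · rfl
    · rfl

/-- Approximate f by log-indices at scale r and erase with p = c / r: the main term is c f, and the
flag's entropy vanishes as r grows. -/
theorem IsEntropic.isAlmostEntropic_const_mul {N : ℕ} {f : Finset (Fin N) → ℝ}
    (hf : IsEntropic f) {c : ℝ} (hc : 0 < c) : IsAlmostEntropic fun α => c * f α := by
  refine isAlmostEntropic_of_forall_approx fun ε hε => ?_
  have hlim : Tendsto (fun r : ℝ => Real.binEntropy (c / r) / Real.log 2) atTop (𝓝 0) := by
    have h1 : Tendsto (fun r : ℝ => c / r) atTop (𝓝 0) := tendsto_const_nhds.div_atTop tendsto_id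
    have := ((Real.binEntropy_continuous.tendsto 0).comp h1).div_const (Real.log 2)
    simpa using this
  obtain ⟨R, hR⟩ := eventually_atTop.1 (hlim.eventually_le_const (half_pos hε))
  obtain ⟨G, hG, hfin, K, r, hr, hr0, hK⟩ :=
    hf.exists_subgroups (show 0 < ε / (2 * c) by positivity) (max R c)
  have hp0 : 0 ≤ c / r := by positivity
  have hp1 : c / r ≤ 1 := (div_le_one hr0).2 ((le_max_right _ _).trans hr)
  refine ⟨_, (isEntropic_erasedUniform K hp0 hp1).isAlmostEntropic, fun α => ?_⟩
  split_ifs with hα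
  · subst hα
    simp [hf.apply_empty, hε.le]
  · have h1 := hR r ((le_max_left _ _).trans hr)
    have h2 : 0 ≤ Real.binEntropy (c / r) / Real.log 2 :=
      div_nonneg (Real.binEntropy_nonneg hp0 hp1) log_two_pos.le
    have h3 : c * |Real.logb 2 (⨅ j ∈ α, K j).index / r - f α| ≤ c * (ε / (2 * c)) :=
      mul_le_mul_of_nonneg_left (hK α) hc.le
    have h4 : c * (ε / (2 * c)) = ε / 2 := by field_simp
    have h5 : Real.binEntropy (c / r) / Real.log 2 + c / r * Real.logb 2 (⨅ j ∈ α, K j).index -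
        c * f α = Real.binEntropy (c / r) / Real.log 2 +
          c * (Real.logb 2 (⨅ j ∈ α, K j).index / r - f α) := by ring
    rw [h5]
    refine (abs_add_le _ _).trans ?_
    rw [abs_of_nonneg h2, abs_mul, abs_of_pos hc]
    linarith

end Scaling

/-! ## Marginals of the joint law -/

section Marginals

theorem independentProduct_map_eval {ι : Type} [Fintype ι] {A : ι → Type} [∀ i, Fintype (A i)]
    (q : ∀ i, PMF (A i)) (i : ι) : (independentProduct q).map (fun x => x i) = q i := by
  classical
  ext a
  rw [PMF.map_apply, tsum_fintype]
  simp only [independentProduct, PMF.ofFintype_apply]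
  -- Fixing coordinate i to `a` and summing out the others is a product of sums; all factors but the
  -- i-th equal 1.
  have h := Finset.prod_univ_sum
    (Function.update (fun i => (Finset.univ : Finset (A i))) i {a}) (fun i a => q i a)
  have h1 : ∀ j, ∑ b ∈ Function.update (fun i => (Finset.univ : Finset (A i))) i {a} j, q j b =
      if j = i then q i a else 1 := by
    intro j
    by_cases hj : j = i
    · subst hj; simp
    · rw [Function.update_of_ne hj, if_neg hj, ← tsum_fintype (L := .unconditional _),
        (q j).tsum_coe]
  rw [Finset.prod_congr rfl fun j _ => h1 j, Finset.prod_ite_eq' Finset.univ i,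
    if_pos (Finset.mem_univ i)] at h
  rw [h, ← Finset.sum_filter]
  refine Finset.sum_congr ?_ fun _ _ => rfl
  ext x
  simp only [Finset.mem_filter, Finset.mem_univ, true_and, Fintype.mem_piFinset]
  constructor
  · rintro rfl j
    by_cases hj : j = i
    · subst hj; simp
    · simp [Function.update_of_ne hj]
  · intro hx
    simpa [eq_comm] using hx i

theorem entropy_uniformOfFintype (A : Type*) [Fintype A] [Nonempty A] :
    entropy (PMF.uniformOfFintype A) = Real.logb 2 (Fintype.card A) := by
  have hA : (Fintype.card A : ℝ) ≠ 0 := by exact_mod_cast Fintype.card_ne_zero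
  rw [entropy_eq_sum]
  simp only [PMF.uniformOfFintype_apply, Finset.sum_const, Finset.card_univ, nsmul_eq_mul,
    Real.negMulLog, ENNReal.toReal_inv, ENNReal.toReal_natCast, Real.log_inv, Real.logb]
  field_simp

variable {P E S : Type} [Fintype P] [Fintype S] {G : Network P E} {M : ConnectionRequirement P S}

theorem NetworkCode.srcEntropy_eq (C : NetworkCode G M) (s : S) :
    C.srcEntropy s = Real.logb 2 (Fintype.card (C.Src s)) := by
  have h : C.jointLaw.map (fun ω => ω.1 s) =
      (independentProduct fun s => PMF.uniformOfFintype (C.Src s)).map (fun t => t s) := by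
    rw [NetworkCode.jointLaw, PMF.map_bind, ← PMF.bind_pure_comp]
    congr 1
    funext t
    rw [PMF.map_comp]
    exact PMF.map_const _ _
  rw [NetworkCode.srcEntropy, h, independentProduct_map_eval, entropy_uniformOfFintype]

/-- It suffices to find codes whose normalized alphabet sizes converge to the capacities and to
the rates. -/
theorem achievable_of_tendsto [Finite E] {rate : S → ℝ} {cap : E → WithTop ℝ}
    (C : ℕ → NetworkCode G M) (r : ℕ → ℝ) (hr : ∀ n, 0 < r n)
    (hcap : ∀ e, ∀ c : ℝ, cap e = (c : WithTop ℝ) →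
      Tendsto (fun n => Real.logb 2 (Fintype.card ((C n).Msg e)) / r n) atTop (𝓝 c))
    (hrate : ∀ s, Tendsto (fun n => Real.logb 2 (Fintype.card ((C n).Src s)) / r n) atTop
      (𝓝 (rate s)))
    (herr : Tendsto (fun n => (C n).errorProb) atTop (𝓝 0)) : Achievable G M rate cap := by
  classical
  cases nonempty_fintype E
  -- Entropy rates need not converge, so a subsequence is extracted by compactness. Uncapacitated
  -- links, whose rates may be unbounded, are set to 0.
  set X : ℕ → E → ℝ := fun n e => if cap e = ⊤ then 0 else (C n).msgEntropy e / r n with hX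
  have hle : ∀ n e, (C n).msgEntropy e / r n ≤
      Real.logb 2 (Fintype.card ((C n).Msg e)) / r n := fun n e =>
    div_le_div_of_nonneg_right (entropy_le_logb_card _) (hr n).le
  have hX0 : ∀ n e, 0 ≤ X n e := by
    intro n e
    simp only [hX]
    split_ifs
    · exact le_rfl
    · exact div_nonneg (entropy_nonneg _) (hr n).le
  have hbdd : ∀ e, ∃ B, ∀ n, X n e ≤ B := by
    intro e
    by_cases he : cap e = ⊤
    · exact ⟨0, fun n => by simp [hX, he]⟩
    · obtain ⟨c, hc⟩ := WithTop.ne_top_iff_exists.1 he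
      obtain ⟨B, hB⟩ := (hcap e c hc.symm).bddAbove_range
      refine ⟨B, fun n => ?_⟩
      simp only [hX, if_neg he]
      exact (hle n e).trans (hB ⟨n, rfl⟩)
  choose B hB using hbdd
  obtain ⟨a, -, φ, hφ, ha⟩ := tendsto_subseq_of_bounded (Metric.isBounded_Icc (0 : E → ℝ) B)
    (x := X) fun n => ⟨fun e => hX0 n e, fun e => hB e n⟩
  refine ⟨fun n => C (φ n), fun n => r (φ n), fun n => hr _, fun e c hc => ⟨a e, c, ?_,
    (hcap e c hc).comp hφ.tendsto_atTop, ?_, le_rfl⟩, fun s => ⟨rate s, ?_,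
    (hrate s).comp hφ.tendsto_atTop, le_rfl⟩, herr.comp hφ.tendsto_atTop⟩
  · refine ((tendsto_pi_nhds.1 ha) e).congr fun n => ?_
    simp [hX, hc]
  · refine le_of_tendsto_of_tendsto ((tendsto_pi_nhds.1 ha) e)
      ((hcap e c hc).comp hφ.tendsto_atTop) (Eventually.of_forall fun n => ?_)
    simp only [Function.comp_apply, hX, hc, WithTop.coe_ne_top, if_false]
    exact hle _ _
  · simp only [NetworkCode.srcEntropy_eq]
    exact (hrate s).comp hφ.tendsto_atTop

end Marginals

/-! ## Deterministic codes -/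

section Deterministic

variable {P E S : Type} {G : Network P E} {M : ConnectionRequirement P S}

open Classical in
/-- The deterministic code with messages `w`, each of which is determined by the data at the tail
of its link. -/
noncomputable def deterministicCode (Src : S → Type) (Msg : E → Type) [∀ s, Fintype (Src s)]
    [∀ s, Nonempty (Src s)] [∀ e, Fintype (Msg e)] (w : ∀ e, (∀ s, Src s) → Msg e)
    (hw : ∀ e t t', (∀ s, M.origin s = G.tail e → t s = t' s) →
      (∀ d, G.head d = G.tail e → w d t = w d t') → w e t = w e t') : NetworkCode G M where
  Src := Src
  Msg := Msg
  Rnd := fun _ => Unit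
  rndLaw := fun _ => PMF.pure ()
  encode := fun e src inc _ =>
    -- Any source tuple consistent with the local data gives the same message by `hw`; the default
    -- branch is never reached by actual messages.
    if h : ∃ t : ∀ s, Src s, (∀ s, t s.1 = src s) ∧ ∀ d, w d.1 t = inc d then w e h.choose
    else w e fun _ => Classical.arbitrary _
  decode := fun u s src inc _ =>
    if h : ∃ t : ∀ s, Src s, (∀ s : {s' // M.origin s' = u}, t s.1 = src s) ∧
      ∀ d : {d // G.head d = u}, w d.1 t = inc d then h.choose s
    else Classical.arbitrary _
  msg := fun e ω => w e ω.1
  causal := by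
    intro e ω
    have h : ∃ t : ∀ s, Src s, (∀ s : {s // M.origin s = G.tail e}, t s.1 = ω.1 s) ∧
        ∀ d : {d // G.head d = G.tail e}, w d.1 t = w d ω.1 := ⟨ω.1, fun _ => rfl, fun _ => rfl⟩
    rw [dif_pos h]
    exact hw e _ _ (fun s hs => (h.choose_spec.1 ⟨s, hs⟩).symm)
      fun d hd => (h.choose_spec.2 ⟨d, hd⟩).symm

theorem deterministicCode_errorProb [Fintype P] [Fintype S] (Src : S → Type) (Msg : E → Type)
    [∀ s, Fintype (Src s)] [∀ s, Nonempty (Src s)] [∀ e, Fintype (Msg e)]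
    (w : ∀ e, (∀ s, Src s) → Msg e)
    (hw : ∀ e t t', (∀ s, M.origin s = G.tail e → t s = t' s) →
      (∀ d, G.head d = G.tail e → w d t = w d t') → w e t = w e t')
    (hdec : ∀ s, ∀ u ∈ M.dest s, ∀ t t', (∀ s, M.origin s = u → t s = t' s) →
      (∀ d, G.head d = u → w d t = w d t') → t s = t' s) :
    (deterministicCode Src Msg w hw).errorProb = 0 := by
  have hest : ∀ s, ∀ u ∈ M.dest s, ∀ ω, (deterministicCode Src Msg w hw).estimate u s ω = ω.1 s := by
    intro s u hu ω
    have h : ∃ t : ∀ s, Src s, (∀ s : {s // M.origin s = u}, t s.1 = ω.1 s) ∧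
        ∀ d : {d // G.head d = u}, w d.1 t = w d ω.1 := ⟨ω.1, fun _ => rfl, fun _ => rfl⟩
    have e : (deterministicCode Src Msg w hw).estimate u s ω = h.choose s := dif_pos h
    rw [e]
    exact hdec s u hu _ _ (fun s hs => h.choose_spec.1 ⟨s, hs⟩)
      fun d hd => h.choose_spec.2 ⟨d, hd⟩
  have : {ω | ∃ s, ∃ u ∈ M.dest s, (deterministicCode Src Msg w hw).estimate u s ω ≠ ω.1 s} =
      ∅ := by
    ext ω
    simp only [Set.mem_ofPred_eq, Set.mem_empty_iff_false, iff_false]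
    rintro ⟨s, u, hu, hne⟩
    exact hne (hest s u hu ω)
  rw [NetworkCode.errorProb, this]
  simp

end Deterministic

/-! ## The code built from subgroups of a finite group -/

/-- The coset spaces need not be groups, so addition modulo the cardinality is transported to them.
-/
theorem exists_latinSquare (A : Type*) [Finite A] [Nonempty A] :
    ∃ L : A → A → A, (∀ u v v', L u v = L u v' → v = v') ∧ ∀ u u' v, L u v = L u' v → u = u' := by
  have : NeZero (Nat.card A) := ⟨Nat.card_pos.ne'⟩
  let e := Finite.equivFin A
  exact ⟨fun u v => e.symm (e u + e v),
    fun u v v' h => e.injective (add_left_cancel (e.symm.injective h)),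
    fun u u' v h => e.injective (add_right_cancel (e.symm.injective h))⟩

theorem quotientEquivProdOfLE_fst {G : Type*} [Group G] {H K : Subgroup G} (h : H ≤ K)
    (y : G ⧸ H) : (Subgroup.quotientEquivProdOfLE h y).1 = Subgroup.quotientMapOfLE h y := by
  rw [Subgroup.quotientEquivProdOfLE_apply]
  rfl

section GroupCode

variable {N : ℕ} {G : Type} [Group G] (K : Fin N → Subgroup G)

/-- The intersection of the subgroups indexed by `α`. -/
def meet (α : Finset (Fin N)) : Subgroup G := ⨅ j ∈ α, K j

theorem meet_anti {α β : Finset (Fin N)} (h : α ⊆ β) : meet K β ≤ meet K α :=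
  le_iInf₂ fun j hj => iInf₂_le j (h hj)

theorem mem_meet {α : Finset (Fin N)} {g : G} : g ∈ meet K α ↔ ∀ j ∈ α, g ∈ K j := by
  simp [meet, Subgroup.mem_iInf]

/-- The coset of `meet K α` that contains a given coset of `meet K univ`. -/
def proj (α : Finset (Fin N)) (x : G ⧸ meet K Finset.univ) : G ⧸ meet K α :=
  Subgroup.quotientMapOfLE (meet_anti K (Finset.subset_univ α)) x

/-- The position of a coset of `meet K β` inside a coset of `meet K α`. -/
noncomputable def rest {α β : Finset (Fin N)} (h : α ⊆ β) (x : G ⧸ meet K Finset.univ) :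
    meet K α ⧸ (meet K β).subgroupOf (meet K α) :=
  (Subgroup.quotientEquivProdOfLE (meet_anti K h) (proj K β x)).2

theorem proj_mk (α : Finset (Fin N)) (g : G) :
    proj K α (g : G ⧸ meet K Finset.univ) = (g : G ⧸ meet K α) :=
  Subgroup.quotientMapOfLE_apply_mk _ g

theorem proj_univ (x : G ⧸ meet K Finset.univ) : proj K Finset.univ x = x := by
  induction x using QuotientGroup.induction_on with
  | H g => exact proj_mk K _ g

theorem proj_congr {α : Finset (Fin N)} {x x' : G ⧸ meet K Finset.univ}
    (h : ∀ j ∈ α, proj K {j} x = proj K {j} x') : proj K α x = proj K α x' := by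
  induction x using QuotientGroup.induction_on with
  | H g =>
    induction x' using QuotientGroup.induction_on with
    | H g' =>
      have h' : ∀ j ∈ α, ((g : G ⧸ meet K {j}) = g') := h
      change (g : G ⧸ meet K α) = g'
      simp only [QuotientGroup.eq, mem_meet] at h' ⊢
      exact fun j hj => h' j hj j (Finset.mem_singleton_self j)

theorem quotientMapOfLE_proj {α β : Finset (Fin N)} (h : α ⊆ β) (x : G ⧸ meet K Finset.univ) :
    Subgroup.quotientMapOfLE (meet_anti K h) (proj K β x) = proj K α x := by
  induction x using QuotientGroup.induction_on with
  | H g => rw [proj_mk, proj_mk, Subgroup.quotientMapOfLE_apply_mk]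

/-- G/K_β is in bijection with G/K_α × K_α/K_β, so `rest` is a lossless conditional description. -/
theorem proj_eq_of_rest {α β : Finset (Fin N)} (hαβ : α ⊆ β) {x x' : G ⧸ meet K Finset.univ}
    (h : proj K α x = proj K α x') (h' : rest K hαβ x = rest K hαβ x') :
    proj K β x = proj K β x' := by
  rw [← quotientMapOfLE_proj K hαβ, ← quotientMapOfLE_proj K hαβ, ← quotientEquivProdOfLE_fst,
    ← quotientEquivProdOfLE_fst] at h
  exact (Subgroup.quotientEquivProdOfLE (meet_anti K hαβ)).injective (Prod.ext h h')

/-- The alphabets of the two sessions. -/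
def groupSrc : Fin 2 → Type
  | 0 => ∀ j : Fin N, G ⧸ meet K {j}
  | 1 => G ⧸ meet K Finset.univ

/-- The alphabets of the links. -/
def groupMsg : DaggerEdge N → Type
  | .U j => G ⧸ meet K {j}
  | .V j => G ⧸ meet K {j}
  | .direct1 α => meet K α.1 ⧸ (meet K Finset.univ).subgroupOf (meet K α.1)
  | .carryV1 _ j => G ⧸ meet K {j.1}
  | .out1 α => G ⧸ meet K α.1
  | .direct2 x => (∀ j : {j // j ≠ x.1.2}, G ⧸ meet K {j.1}) ×
      (meet K {x.1.2} ⧸ (meet K Finset.univ).subgroupOf (meet K {x.1.2}))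
  | .coderU x => G ⧸ meet K {x.1.2}
  | .coderV x => G ⧸ meet K {x.1.2}
  | .linkW1 x => G ⧸ meet K {x.1.2}
  | .forkP0 x => G ⧸ meet K {x.1.2}
  | .forkP1 x => G ⧸ meet K {x.1.2}
  | .linkW2 x => G ⧸ meet K {x.1.2}
  | .outP0 x => (G ⧸ meet K {x.1.2}) × (G ⧸ meet K {x.1.2})
  | .helperVi x => G ⧸ meet K {x.1.2}
  | .helperV _ j => G ⧸ meet K {j.1}
  | .linkW4 x => meet K x.1.1 ⧸ (meet K (insert x.1.2 x.1.1)).subgroupOf (meet K x.1.1)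
  | .carryV2 _ j => G ⧸ meet K {j.1}
  | .linkW3 x => G ⧸ meet K {x.1.2}
  | .carryU2 _ j => G ⧸ meet K {j.1}

/-- The message `U_j`. -/
def srcU (t : ∀ s, groupSrc K s) (j : Fin N) : G ⧸ meet K {j} :=
  (t 0 : ∀ j : Fin N, G ⧸ meet K {j}) j

/-- The message of session `S_1`. -/
def srcCoset (t : ∀ s, groupSrc K s) : G ⧸ meet K Finset.univ := t 1

/-- The message `V_j`. -/
def srcV (t : ∀ s, groupSrc K s) (j : Fin N) : G ⧸ meet K {j} := proj K {j} (srcCoset K t)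

/-- The link messages; `L` adds `U_i` and `V_i`. -/
noncomputable def groupMessage (L : ∀ j, G ⧸ meet K {j} → G ⧸ meet K {j} → G ⧸ meet K {j}) :
    ∀ e, (∀ s, groupSrc K s) → groupMsg K e
  | .U j, t => srcU K t j
  | .V j, t => srcV K t j
  | .direct1 α, t => rest K (Finset.subset_univ α.1) (srcCoset K t)
  | .carryV1 _ j, t => srcV K t j.1
  | .out1 α, t => proj K α.1 (srcCoset K t)
  | .direct2 x, t =>
    (fun j => srcU K t j.1, rest K (Finset.subset_univ {x.1.2}) (srcCoset K t))
  | .coderU x, t => srcU K t x.1.2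
  | .coderV x, t => srcV K t x.1.2
  | .linkW1 x, t => L _ (srcU K t x.1.2) (srcV K t x.1.2)
  | .forkP0 x, t => L _ (srcU K t x.1.2) (srcV K t x.1.2)
  | .forkP1 x, t => L _ (srcU K t x.1.2) (srcV K t x.1.2)
  | .linkW2 x, t => srcU K t x.1.2
  | .outP0 x, t => (L _ (srcU K t x.1.2) (srcV K t x.1.2), srcU K t x.1.2)
  | .helperVi x, t => srcV K t x.1.2
  | .helperV _ j, t => srcV K t j.1
  | .linkW4 x, t => rest K (Finset.subset_insert x.1.2 x.1.1) (srcCoset K t)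
  | .carryV2 _ j, t => srcV K t j.1
  | .linkW3 x, t => srcU K t x.1.2
  | .carryU2 _ j, t => srcU K t j.1

theorem groupMessage_causal {L : ∀ j, G ⧸ meet K {j} → G ⧸ meet K {j} → G ⧸ meet K {j}}
    (hL : ∀ j u u' v, L j u v = L j u' v → u = u') (e : DaggerEdge N) (t t' : ∀ s, groupSrc K s)
    (hs : ∀ s, (daggerRequirement N).origin s = (daggerNetwork N).tail e → t s = t' s)
    (hd : ∀ d, (daggerNetwork N).head d = (daggerNetwork N).tail e →
      groupMessage K L d t = groupMessage K L d t') :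
    groupMessage K L e t = groupMessage K L e t' := by
  have source : (daggerNetwork N).tail e = .source →
      groupMessage K L e t = groupMessage K L e t' := fun h => by
    have : t = t' := funext fun s => hs s h.symm
    rw [this]
  cases e with
  | U j => exact source rfl
  | V j => exact source rfl
  | direct1 α => exact source rfl
  | direct2 x => exact source rfl
  | carryV1 α j => exact hd (.V j) rfl
  | out1 α => exact proj_congr K fun j hj => hd (.carryV1 α ⟨j, hj⟩) rfl
  | coderU x => exact hd (.U x.1.2) rfl
  | coderV x => exact hd (.V x.1.2) rfl
  | linkW1 x => exact congrArg₂ (L _) (hd (.coderU x) rfl) (hd (.coderV x) rfl)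
  | forkP0 x => exact hd (.linkW1 x) rfl
  | forkP1 x => exact hd (.linkW1 x) rfl
  | linkW2 x => exact hd (.U x.1.2) rfl
  | outP0 x => exact Prod.ext (hd (.forkP0 x) rfl) (hd (.linkW2 x) rfl)
  | helperVi x => exact hd (.V x.1.2) rfl
  | helperV x j => exact hd (.V j) rfl
  | linkW4 x =>
    have h1 : proj K (insert x.1.2 x.1.1) (srcCoset K t) =
        proj K (insert x.1.2 x.1.1) (srcCoset K t') := by
      refine proj_congr K fun j hj => ?_
      rcases Finset.mem_insert.1 hj with rfl | hj
      · exact hd (.helperVi x) rfl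
      · exact hd (.helperV x ⟨j, hj⟩) rfl
    change rest K (Finset.subset_insert _ _) (srcCoset K t) =
      rest K (Finset.subset_insert _ _) (srcCoset K t')
    unfold rest
    rw [h1]
  | carryV2 x j => exact hd (.V j) rfl
  | linkW3 x =>
    have h1 : proj K x.1.1 (srcCoset K t) = proj K x.1.1 (srcCoset K t') :=
      proj_congr K fun j hj => hd (.carryV2 x ⟨j, hj⟩) rfl
    -- V_α and W_4 yield V_i; cancelling V_i from the Latin square symbol W_1 leaves U_i.
    have h2 := proj_eq_of_rest K (Finset.subset_insert x.1.2 x.1.1) h1 (hd (.linkW4 x) rfl)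
    have h3 : srcV K t x.1.2 = srcV K t' x.1.2 := by
      have hsub : {x.1.2} ⊆ insert x.1.2 x.1.1 := by simp
      unfold srcV
      rw [← quotientMapOfLE_proj K hsub, ← quotientMapOfLE_proj K hsub, h2]
    have h4 : L x.1.2 (srcU K t x.1.2) (srcV K t x.1.2) =
        L x.1.2 (srcU K t' x.1.2) (srcV K t' x.1.2) := hd (.forkP1 x) rfl
    rw [h3] at h4
    exact hL _ _ _ _ h4
  | carryU2 x j => exact hd (.U j) rfl

theorem groupMessage_decodable {L : ∀ j, G ⧸ meet K {j} → G ⧸ meet K {j} → G ⧸ meet K {j}}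
    (hL : ∀ j u v v', L j u v = L j u v' → v = v') (s : Fin 2) (u : DaggerNode N)
    (hu : u ∈ (daggerRequirement N).dest s) (t t' : ∀ s, groupSrc K s)
    (hd : ∀ d, (daggerNetwork N).head d = u → groupMessage K L d t = groupMessage K L d t') :
    t s = t' s := by
  have one : ∀ α : Finset (Fin N), proj K α (srcCoset K t) = proj K α (srcCoset K t') →
      rest K (Finset.subset_univ α) (srcCoset K t) =
        rest K (Finset.subset_univ α) (srcCoset K t') → t 1 = t' 1 := fun α h h' => by
    have := proj_eq_of_rest K (Finset.subset_univ α) h h'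
    rwa [proj_univ, proj_univ] at this
  have zero : (∀ j, srcU K t j = srcU K t' j) → t 0 = t' 0 := fun h => funext h
  have upper : ∀ x : Index2 N, u = .upper x → t s = t' s := by
    rintro x rfl
    have h1 := Prod.ext_iff.1 (hd (.direct2 x) rfl)
    have h2 := Prod.ext_iff.1 (hd (.outP0 x) rfl)
    have hU : srcU K t x.1.2 = srcU K t' x.1.2 := h2.2
    have hW : L x.1.2 (srcU K t x.1.2) (srcV K t x.1.2) =
        L x.1.2 (srcU K t' x.1.2) (srcV K t' x.1.2) := h2.1
    rw [hU] at hW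
    match s with
    | 0 =>
      refine zero fun j => ?_
      by_cases hj : j = x.1.2
      · subst hj; exact hU
      · exact congrFun h1.1 ⟨j, hj⟩
    | 1 => exact one _ (hL _ _ _ _ hW) h1.2
  have lower : ∀ x : Index2 N, u = .lower x → t 0 = t' 0 := by
    rintro x rfl
    refine zero fun j => ?_
    by_cases hj : j = x.1.2
    · subst hj; exact hd (.linkW3 x) rfl
    · exact hd (.carryU2 x ⟨j, hj⟩) rfl
  have sink : ∀ α : Index1 N, u = .sink α → t 1 = t' 1 := by
    rintro α rfl
    exact one _ (hd (.out1 α) rfl) (hd (.direct1 α) rfl)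
  match s with
  | 0 =>
    obtain ⟨x, h | h⟩ : ∃ x, u = .upper x ∨ u = .lower x := hu
    · exact upper x h
    · exact lower x h
  | 1 =>
    obtain ⟨α, h⟩ | ⟨x, h⟩ : (∃ α, u = .sink α) ∨ ∃ x, u = .upper x := hu
    · exact sink α h
    · exact upper x h

theorem logb_index_eq_add [Finite G] {α β : Finset (Fin N)} (h : α ⊆ β) :
    Real.logb 2 (Nat.card (meet K α ⧸ (meet K β).subgroupOf (meet K α))) =
      Real.logb 2 (meet K β).index - Real.logb 2 (meet K α).index := by
  have h1 := Subgroup.relIndex_mul_index (meet_anti K h)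
  have h2 : (meet K α).index ≠ 0 := Subgroup.index_ne_zero_of_finite
  have h3 : (meet K β).relIndex (meet K α) ≠ 0 := Subgroup.index_ne_zero_of_finite
  change Real.logb 2 ((meet K β).relIndex (meet K α) : ℝ) = _
  rw [← h1, Nat.cast_mul, Real.logb_mul (by exact_mod_cast h3) (by exact_mod_cast h2)]
  ring

instance [Finite G] (s : Fin 2) : Finite (groupSrc K s) :=
  match s with
  | 0 => inferInstanceAs (Finite (∀ j : Fin N, G ⧸ meet K {j}))
  | 1 => inferInstanceAs (Finite (G ⧸ meet K Finset.univ))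

instance (s : Fin 2) : Nonempty (groupSrc K s) :=
  match s with
  | 0 => inferInstanceAs (Nonempty (∀ j : Fin N, G ⧸ meet K {j}))
  | 1 => inferInstanceAs (Nonempty (G ⧸ meet K Finset.univ))

instance [Finite G] (e : DaggerEdge N) : Finite (groupMsg K e) := by
  cases e <;> (unfold groupMsg; infer_instance)

theorem logb_card_groupSrc [Finite G] (s : Fin 2) :
    Real.logb 2 (Nat.card (groupSrc K s)) =
      daggerRate (fun α => Real.logb 2 (meet K α).index) s := by
  match s with
  | 0 =>
    change Real.logb 2 (Nat.card (∀ j : Fin N, G ⧸ meet K {j})) =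
      ∑ j, Real.logb 2 (meet K {j}).index
    rw [Nat.card_pi, Nat.cast_prod, Real.logb_prod]
    · rfl
    · intro j _
      exact_mod_cast (Nat.card_pos (α := G ⧸ meet K {j})).ne'
  | 1 => rfl

theorem logb_card_groupMsg [Finite G] (e : DaggerEdge N) (c : ℝ)
    (h : daggerCapacity (fun α => Real.logb 2 (meet K α).index) e = (c : WithTop ℝ)) :
    Real.logb 2 (Nat.card (groupMsg K e)) = c := by
  cases e <;> simp only [daggerCapacity, WithTop.coe_inj, WithTop.top_ne_coe] at h <;> subst h
  case direct1 α => exact logb_index_eq_add K (Finset.subset_univ _)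
  case linkW4 x => exact logb_index_eq_add K (Finset.subset_insert _ _)
  case direct2 x =>
    have h1 : ∀ j : Fin N, (Nat.card (G ⧸ meet K {j}) : ℝ) ≠ 0 := fun j => by
      exact_mod_cast (Nat.card_pos (α := G ⧸ meet K {j})).ne'
    change Real.logb 2 (Nat.card ((∀ j : {j // j ≠ x.1.2}, G ⧸ meet K {j.1}) ×
      (meet K {x.1.2} ⧸ (meet K Finset.univ).subgroupOf (meet K {x.1.2})))) = _
    rw [Nat.card_prod, Nat.cast_mul, Real.logb_mul, logb_index_eq_add K (Finset.subset_univ _),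
      Nat.card_pi, Nat.cast_prod, Real.logb_prod]
    · have h2 := Fintype.sum_eq_add_sum_subtype_ne
        (fun j => Real.logb 2 (meet K {j}).index) x.1.2
      rw [h2]
      change ∑ j : {j // j ≠ x.1.2}, Real.logb 2 (meet K {j.1}).index + _ = _
      ring
    · exact fun j _ => h1 j.1
    · rw [Nat.card_pi, Nat.cast_prod]
      exact Finset.prod_ne_zero_iff.2 fun j _ => h1 j.1
    · exact_mod_cast Nat.card_pos.ne'
  all_goals rfl

/-- A family of subgroups of a finite group yields a code without errors whose alphabet sizes are
given by the logarithms of the indices. -/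
theorem exists_groupCode [Finite G] :
    ∃ C : NetworkCode (daggerNetwork N) (daggerRequirement N), C.errorProb = 0 ∧
      (∀ e, ∀ c : ℝ, daggerCapacity (fun α => Real.logb 2 (⨅ j ∈ α, K j).index) e =
        (c : WithTop ℝ) → Real.logb 2 (Fintype.card (C.Msg e)) = c) ∧
      ∀ s, Real.logb 2 (Fintype.card (C.Src s)) =
        daggerRate (fun α => Real.logb 2 (⨅ j ∈ α, K j).index) s := by
  choose L hL hL' using fun j : Fin N => exists_latinSquare (G ⧸ meet K {j})
  let _ : ∀ s, Fintype (groupSrc K s) := fun s => Fintype.ofFinite _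
  let _ : ∀ e, Fintype (groupMsg K e) := fun e => Fintype.ofFinite _
  refine ⟨deterministicCode (groupSrc K) (groupMsg K) (groupMessage K L)
    (groupMessage_causal K hL'), deterministicCode_errorProb _ _ _ _
    fun s u hu t t' _ hd => groupMessage_decodable K hL s u hu t t' hd, fun e c h => ?_,
    fun s => ?_⟩
  · rw [Fintype.card_eq_nat_card]
    exact logb_card_groupMsg K e c h
  · rw [Fintype.card_eq_nat_card]
    exact logb_card_groupSrc K s

end GroupCode

/-! ## Almost entropic functions are achievable -/

theorem tendsto_daggerCapacity {N : ℕ} {g : ℕ → Finset (Fin N) → ℝ} {h : Finset (Fin N) → ℝ}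
    (hg : Tendsto g atTop (𝓝 h)) (e : DaggerEdge N) (c : ℝ)
    (hc : daggerCapacity h e = (c : WithTop ℝ)) :
    ∃ d : ℕ → ℝ, (∀ n, daggerCapacity (g n) e = (d n : WithTop ℝ)) ∧
      Tendsto d atTop (𝓝 c) := by
  have hg' : ∀ α, Tendsto (fun n => g n α) atTop (𝓝 (h α)) := tendsto_pi_nhds.1 hg
  cases e <;> simp only [daggerCapacity, WithTop.coe_inj, WithTop.top_ne_coe] at hc <;> subst hc
  case direct1 α => exact ⟨_, fun n => rfl, (hg' _).sub (hg' _)⟩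
  case linkW4 x => exact ⟨_, fun n => rfl, (hg' _).sub (hg' _)⟩
  case direct2 x =>
    exact ⟨_, fun n => rfl, ((hg' _).add (tendsto_finsetSum _ fun j _ => hg' _)).sub
      ((hg' _).const_mul 2)⟩
  all_goals exact ⟨_, fun n => rfl, hg' _⟩

theorem tendsto_daggerRate {N : ℕ} {g : ℕ → Finset (Fin N) → ℝ} {h : Finset (Fin N) → ℝ}
    (hg : Tendsto g atTop (𝓝 h)) (s : Fin 2) :
    Tendsto (fun n => daggerRate (g n) s) atTop (𝓝 (daggerRate h s)) := by
  have hg' : ∀ α, Tendsto (fun n => g n α) atTop (𝓝 (h α)) := tendsto_pi_nhds.1 hg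
  match s with
  | 0 => exact tendsto_finsetSum Finset.univ fun j _ => hg' {j}
  | 1 => exact hg' _

theorem daggerCapacity_div {N : ℕ} (g : Finset (Fin N) → ℝ) (r : ℝ) (e : DaggerEdge N) (d : ℝ)
    (h : daggerCapacity (fun α => g α / r) e = (d : WithTop ℝ)) :
    ∃ c : ℝ, daggerCapacity g e = (c : WithTop ℝ) ∧ c / r = d := by
  cases e <;> simp only [daggerCapacity, WithTop.coe_inj, WithTop.top_ne_coe] at h <;> subst h
  case direct1 α => exact ⟨_, rfl, sub_div _ _ _⟩
  case linkW4 x => exact ⟨_, rfl, sub_div _ _ _⟩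
  case direct2 x =>
    refine ⟨_, rfl, ?_⟩
    rw [sub_div, add_div, Finset.sum_div, mul_div_assoc]
  all_goals exact ⟨_, rfl, rfl⟩

theorem daggerRate_div {N : ℕ} (g : Finset (Fin N) → ℝ) (r : ℝ) (s : Fin 2) :
    daggerRate (fun α => g α / r) s = daggerRate g s / r := by
  match s with
  | 0 =>
    change ∑ j, g {j} / r = (∑ j, g {j}) / r
    rw [Finset.sum_div]
  | 1 => rfl

/-- Group codes meet the tuple of a nearby g exactly, and the tuple depends linearly, hence
continuously, on g. -/
theorem IsAlmostEntropic.achievable {N : ℕ} {h : Finset (Fin N) → ℝ} (hh : IsAlmostEntropic h) :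
    Achievable (daggerNetwork N) (daggerRequirement N) (daggerRate h) (daggerCapacity h) := by
  have step : ∀ n : ℕ, ∃ (C : NetworkCode (daggerNetwork N) (daggerRequirement N)) (r : ℝ)
      (g : Finset (Fin N) → ℝ), 0 < r ∧ (∀ α, |g α - h α| ≤ 1 / ((n : ℝ) + 1)) ∧
      C.errorProb = 0 ∧ (∀ e, ∀ d : ℝ, daggerCapacity g e = (d : WithTop ℝ) →
        Real.logb 2 (Fintype.card (C.Msg e)) / r = d) ∧
      ∀ s, Real.logb 2 (Fintype.card (C.Src s)) / r = daggerRate g s := by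
    intro n
    obtain ⟨G, _, _, K, r, hr, hK⟩ :=
      hh.exists_subgroups (show (0 : ℝ) < 1 / ((n : ℝ) + 1) by positivity)
    obtain ⟨C, hC, hmsg, hsrc⟩ := exists_groupCode K
    refine ⟨C, r, fun α => Real.logb 2 (⨅ j ∈ α, K j).index / r, hr, hK, hC, fun e d hd => ?_,
      fun s => ?_⟩
    · obtain ⟨c, hc, rfl⟩ := daggerCapacity_div _ _ _ _ hd
      rw [hmsg e c hc]
    · rw [daggerRate_div, hsrc s]
  choose C r g hr hg herr hmsg hsrc using step
  have hlim : Tendsto g atTop (𝓝 h) := by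
    refine tendsto_pi_nhds.2 fun α => tendsto_iff_dist_tendsto_zero.2 ?_
    exact squeeze_zero (fun _ => dist_nonneg) (fun n => hg n α)
      tendsto_one_div_add_atTop_nhds_zero_nat
  refine achievable_of_tendsto C r hr (fun e c hc => ?_) (fun s => ?_) ?_
  · obtain ⟨d, hd, hlimd⟩ := tendsto_daggerCapacity hlim e c hc
    exact hlimd.congr fun n => (hmsg n e (d n) (hd n)).symm
  · exact (tendsto_daggerRate hlim s).congr fun n => (hsrc n s).symm
  · simp only [herr]
    exact tendsto_const_nhds

/-! ## Codes without errors on a finite uniform space -/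

section Converse

variable {N : ℕ} {Ω : Type} {Src : Fin 2 → Type} {Msg : DaggerEdge N → Type}

/-- On the space `Ω`, the messages `W` are causal and the sessions `T` are decoded without error;
a point of `Ω` is determined by the sessions. -/
structure ZeroErrorScheme (T : ∀ s, Ω → Src s) (W : ∀ e, Ω → Msg e) : Prop where
  injective : ∀ ω ω', T 0 ω = T 0 ω' → T 1 ω = T 1 ω' → ω = ω'
  causal : ∀ e ω ω', (∀ s, (daggerRequirement N).origin s = (daggerNetwork N).tail e →
    T s ω = T s ω') → (∀ d, (daggerNetwork N).head d = (daggerNetwork N).tail e →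
    W d ω = W d ω') → W e ω = W e ω'
  decodable : ∀ s, ∀ u ∈ (daggerRequirement N).dest s, ∀ ω ω',
    (∀ s, (daggerRequirement N).origin s = u → T s ω = T s ω') →
    (∀ d, (daggerNetwork N).head d = u → W d ω = W d ω') → T s ω = T s ω'

/-! ### What the messages of each subnetwork determine -/

namespace ZeroErrorScheme

variable {T : ∀ s, Ω → Src s} {W : ∀ e, Ω → Msg e} {ω ω' : Ω}

theorem sink_eq (Z : ZeroErrorScheme T W) (α : Index1 N)
    (hD : W (.direct1 α) ω = W (.direct1 α) ω')
    (hV : ∀ j ∈ α.1, W (.V j) ω = W (.V j) ω') : T 1 ω = T 1 ω' := by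
  have h1 : ∀ j : {j // j ∈ α.1}, W (.carryV1 α j) ω = W (.carryV1 α j) ω' := fun j => by
    -- Sessions originate only at the source, so none is available at this tail; `cases d` then
    -- isolates the links entering it.
    refine Z.causal _ _ _ (fun s hs => nomatch hs) fun d hd => ?_
    cases d <;> simp [daggerNetwork, DaggerEdge.head, DaggerEdge.tail] at hd
    subst hd
    exact hV _ j.2
  have h2 : W (.out1 α) ω = W (.out1 α) ω' := by
    refine Z.causal _ _ _ (fun s hs => nomatch hs) fun d hd => ?_
    cases d <;> simp [daggerNetwork, DaggerEdge.head, DaggerEdge.tail] at hd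
    subst hd
    exact h1 _
  refine Z.decodable 1 (.sink α) (Or.inl ⟨α, rfl⟩) _ _ (fun s hs => nomatch hs) fun d hd => ?_
  cases d <;> simp [daggerNetwork, DaggerEdge.head] at hd
  · subst hd; exact hD
  · subst hd; exact h2

theorem lower_eq (Z : ZeroErrorScheme T W) (x : Index2 N)
    (hW : W (.linkW3 x) ω = W (.linkW3 x) ω')
    (hU : ∀ j, j ≠ x.1.2 → W (.U j) ω = W (.U j) ω') : T 0 ω = T 0 ω' := by
  have h1 : ∀ j : {j // j ≠ x.1.2}, W (.carryU2 x j) ω = W (.carryU2 x j) ω' := fun j => by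
    refine Z.causal _ _ _ (fun s hs => nomatch hs) fun d hd => ?_
    cases d <;> simp [daggerNetwork, DaggerEdge.head, DaggerEdge.tail] at hd
    subst hd
    exact hU _ j.2
  refine Z.decodable 0 (.lower x) ⟨x, Or.inr rfl⟩ _ _ (fun s hs => nomatch hs) fun d hd => ?_
  cases d <;> simp [daggerNetwork, DaggerEdge.head] at hd
  · subst hd; exact hW
  · subst hd; exact h1 _

theorem linkW1_eq (Z : ZeroErrorScheme T W) (x : Index2 N)
    (hU : W (.U x.1.2) ω = W (.U x.1.2) ω') (hV : W (.V x.1.2) ω = W (.V x.1.2) ω') :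
    W (.linkW1 x) ω = W (.linkW1 x) ω' := by
  have h1 : W (.coderU x) ω = W (.coderU x) ω' := by
    refine Z.causal _ _ _ (fun s hs => nomatch hs) fun d hd => ?_
    cases d <;> simp [daggerNetwork, DaggerEdge.head, DaggerEdge.tail] at hd
    subst hd
    exact hU
  have h2 : W (.coderV x) ω = W (.coderV x) ω' := by
    refine Z.causal _ _ _ (fun s hs => nomatch hs) fun d hd => ?_
    cases d <;> simp [daggerNetwork, DaggerEdge.head, DaggerEdge.tail] at hd
    subst hd
    exact hV
  refine Z.causal _ _ _ (fun s hs => nomatch hs) fun d hd => ?_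
  cases d <;> simp [daggerNetwork, DaggerEdge.head, DaggerEdge.tail] at hd
  · subst hd; exact h1
  · subst hd; exact h2

theorem upper_eq (Z : ZeroErrorScheme T W) (x : Index2 N)
    (hD : W (.direct2 x) ω = W (.direct2 x) ω') (hW : W (.linkW1 x) ω = W (.linkW1 x) ω')
    (hU : W (.U x.1.2) ω = W (.U x.1.2) ω') : ω = ω' := by
  have h1 : W (.forkP0 x) ω = W (.forkP0 x) ω' := by
    refine Z.causal _ _ _ (fun s hs => nomatch hs) fun d hd => ?_
    cases d <;> simp [daggerNetwork, DaggerEdge.head, DaggerEdge.tail] at hd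
    subst hd
    exact hW
  have h2 : W (.linkW2 x) ω = W (.linkW2 x) ω' := by
    refine Z.causal _ _ _ (fun s hs => nomatch hs) fun d hd => ?_
    cases d <;> simp [daggerNetwork, DaggerEdge.head, DaggerEdge.tail] at hd
    subst hd
    exact hU
  have h3 : W (.outP0 x) ω = W (.outP0 x) ω' := by
    refine Z.causal _ _ _ (fun s hs => nomatch hs) fun d hd => ?_
    cases d <;> simp [daggerNetwork, DaggerEdge.head, DaggerEdge.tail] at hd
    · subst hd; exact h1
    · subst hd; exact h2
  have h4 : ∀ s, DaggerNode.upper x ∈ (daggerRequirement N).dest s → T s ω = T s ω' := by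
    intro s hs
    refine Z.decodable s (.upper x) hs _ _ (fun s hs => nomatch hs) fun d hd => ?_
    cases d <;> simp [daggerNetwork, DaggerEdge.head] at hd
    · subst hd; exact hD
    · subst hd; exact h3
  exact Z.injective _ _ (h4 0 ⟨x, Or.inl rfl⟩) (h4 1 (Or.inr ⟨x, rfl⟩))

theorem linkW3_eq (Z : ZeroErrorScheme T W) (x : Index2 N)
    (h1 : W (.linkW1 x) ω = W (.linkW1 x) ω') (h4 : W (.linkW4 x) ω = W (.linkW4 x) ω')
    (hV : ∀ j ∈ x.1.1, W (.V j) ω = W (.V j) ω') : W (.linkW3 x) ω = W (.linkW3 x) ω' := by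
  have h5 : W (.forkP1 x) ω = W (.forkP1 x) ω' := by
    refine Z.causal _ _ _ (fun s hs => nomatch hs) fun d hd => ?_
    cases d <;> simp [daggerNetwork, DaggerEdge.head, DaggerEdge.tail] at hd
    subst hd
    exact h1
  have h6 : ∀ j : {j // j ∈ x.1.1}, W (.carryV2 x j) ω = W (.carryV2 x j) ω' := fun j => by
    refine Z.causal _ _ _ (fun s hs => nomatch hs) fun d hd => ?_
    cases d <;> simp [daggerNetwork, DaggerEdge.head, DaggerEdge.tail] at hd
    subst hd
    exact hV _ j.2
  refine Z.causal _ _ _ (fun s hs => nomatch hs) fun d hd => ?_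
  cases d <;> simp [daggerNetwork, DaggerEdge.head, DaggerEdge.tail] at hd
  · subst hd; exact h5
  · subst hd; exact h4
  · subst hd; exact h6 _

/-! ### Entropy inequalities forced by exact decoding -/

section Bounds

/-- The tuple of the messages `V_j`, `j ∈ α`. -/
def tupleV (W : ∀ e, Ω → Msg e) (α : Finset (Fin N)) (ω : Ω) (j : α) : Msg (.V j.1) := W (.V j) ω

/-- The tuple of the messages `U_j`, `j ≠ i`. -/
def tupleU (W : ∀ e, Ω → Msg e) (i : Fin N) (ω : Ω) (j : {j // j ≠ i}) : Msg (.U j.1) :=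
  W (.U j) ω

theorem tupleV_apply {α : Finset (Fin N)} (h : tupleV W α ω = tupleV W α ω') {j : Fin N}
    (hj : j ∈ α) : W (.V j) ω = W (.V j) ω' :=
  congrFun h ⟨j, hj⟩

theorem tupleV_ext {α : Finset (Fin N)} (h : ∀ j ∈ α, W (.V j) ω = W (.V j) ω') :
    tupleV W α ω = tupleV W α ω' :=
  funext fun j => h j.1 j.2

theorem tupleU_apply {i : Fin N} (h : tupleU W i ω = tupleU W i ω') {j : Fin N}
    (hj : j ≠ i) : W (.U j) ω = W (.U j) ω' :=
  congrFun h ⟨j, hj⟩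

/-- The data that determine the session `S_0` at the lower receiver. -/
def lowerData (W : ∀ e, Ω → Msg e) (x : Index2 N) (ω : Ω) :=
  ((W (.linkW1 x) ω, W (.linkW4 x) ω), tupleV W x.1.1 ω, tupleU W x.1.2 ω)

theorem lowerData_iff {x : Index2 N} : lowerData W x ω = lowerData W x ω' ↔
    (W (.linkW1 x) ω = W (.linkW1 x) ω' ∧ W (.linkW4 x) ω = W (.linkW4 x) ω') ∧
    tupleV W x.1.1 ω = tupleV W x.1.1 ω' ∧ tupleU W x.1.2 ω = tupleU W x.1.2 ω' := by
  simp [lowerData]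

theorem session_zero_eq_of_lowerData (Z : ZeroErrorScheme T W) (x : Index2 N)
    (h : lowerData W x ω = lowerData W x ω') : T 0 ω = T 0 ω' := by
  rw [lowerData_iff] at h
  exact Z.lower_eq x (Z.linkW3_eq x h.1.1 h.1.2 fun _ hj => tupleV_apply h.2.1 hj)
    fun _ hj => tupleU_apply h.2.2 hj

theorem logb_card_le_add [Fintype Ω] (Z : ZeroErrorScheme T W) :
    Real.logb 2 (Fintype.card Ω) ≤ uniformEntropy (T 0) + uniformEntropy (T 1) := by
  rw [← uniformEntropy_of_injective (X := fun ω : Ω => ω) fun _ _ h => h]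
  exact uniformEntropy_le_add Z.injective

variable [Fintype Ω] [Nonempty Ω] [∀ e, Fintype (Msg e)]

/-- The size of the alphabet of a link in bits. -/
noncomputable def linkBits (Msg : DaggerEdge N → Type) [∀ e, Fintype (Msg e)] (e : DaggerEdge N) : ℝ :=
  Real.logb 2 (Fintype.card (Msg e))

theorem entropy_le_linkBits (W : ∀ e, Ω → Msg e) (e : DaggerEdge N) :
    uniformEntropy (W e) ≤ linkBits Msg e :=
  uniformEntropy_le_logb_card _

theorem entropy_tupleU_le (W : ∀ e, Ω → Msg e) (i : Fin N) :
    uniformEntropy (tupleU W i) ≤ ∑ j : {j // j ≠ i}, linkBits Msg (.U j.1) := by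
  classical
  refine (uniformEntropy_le_logb_card _).trans (le_of_eq ?_)
  rw [Fintype.card_pi, Nat.cast_prod, Real.logb_prod]
  · rfl
  · intro j _
    exact_mod_cast (Fintype.card_pos_iff.2 ⟨W (.U j.1) (Classical.arbitrary Ω)⟩).ne'

theorem entropy_session_one_le (Z : ZeroErrorScheme T W) (α : Index1 N) :
    uniformEntropy (T 1) ≤ linkBits Msg (.direct1 α) + uniformEntropy (tupleV W α.1) :=
  (uniformEntropy_le_add (X := W (.direct1 α)) (Y := tupleV W α.1) fun _ _ hD hV =>
    Z.sink_eq α hD fun _ hj => tupleV_apply hV hj).trans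
    (add_le_add_left (entropy_le_linkBits W _) _)

/-- The sink of {j} recovers S_1 from V_j and its direct link, so H(V_j, S_1) has at most about h(N)
bits and V_j is nearly a function of S_1. Submodularity over S_1 adds up the small excesses. -/
theorem entropy_tupleV_session_one_le (Z : ZeroErrorScheme T W) (β : Finset (Fin N)) :
    uniformEntropy (fun ω => (tupleV W β ω, T 1 ω)) ≤ uniformEntropy (T 1) +
      ∑ j ∈ β, (linkBits Msg (.direct1 ⟨{j}, Finset.singleton_nonempty j⟩) +
        linkBits Msg (.V j) - uniformEntropy (T 1)) := by
  classical
  induction β using Finset.induction_on with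
  | empty =>
    rw [Finset.sum_empty, add_zero]
    exact uniformEntropy_le_of_determined fun ω ω' h =>
      Prod.ext (tupleV_ext fun j hj => absurd hj (Finset.notMem_empty j)) h
  | insert j β hj ih =>
    have h1 : uniformEntropy (fun ω => (W (.V j) ω, T 1 ω)) ≤
        linkBits Msg (.direct1 ⟨{j}, Finset.singleton_nonempty j⟩) + linkBits Msg (.V j) :=
      (uniformEntropy_le_add (X := W (.direct1 ⟨{j}, Finset.singleton_nonempty j⟩))
        (Y := W (.V j)) fun _ _ hD hV => Prod.ext hV (Z.sink_eq _ hD fun i hi => by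
          rw [Finset.mem_singleton.1 hi]; exact hV)).trans
        (add_le_add (entropy_le_linkBits W _) (entropy_le_linkBits W _))
    have h2 := uniformEntropy_submodular (X := fun ω => (tupleV W β ω, T 1 ω))
      (Y := fun ω => (W (.V j) ω, T 1 ω)) (Z := T 1)
      (W := fun ω => (tupleV W (insert j β) ω, T 1 ω))
      (fun ω ω' hX hY => by
        have hX' := Prod.ext_iff.1 hX
        have hY' := Prod.ext_iff.1 hY
        refine Prod.ext (tupleV_ext fun i hi => ?_) hX'.2
        rcases Finset.mem_insert.1 hi with rfl | hi
        · exact hY'.1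
        · exact tupleV_apply hX'.1 hi)
      (fun _ _ h => (Prod.ext_iff.1 h).2) (fun _ _ h => (Prod.ext_iff.1 h).2)
    rw [Finset.sum_insert hj]
    linarith

/-- The message `U_i` is nearly determined by the session `S_0`. -/
theorem entropy_U_session_zero_le (Z : ZeroErrorScheme T W) (x : Index2 N) {i : Fin N}
    (hi : i ≠ x.1.2) :
    uniformEntropy (fun ω => (W (.U i) ω, T 0 ω)) ≤ linkBits Msg (.linkW3 x) +
      ∑ j : {j // j ≠ x.1.2}, linkBits Msg (.U j.1) :=
  (uniformEntropy_le_add (X := W (.linkW3 x)) (Y := tupleU W x.1.2) fun _ _ hW hU =>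
    Prod.ext (tupleU_apply hU hi) (Z.lower_eq x hW fun _ hj => tupleU_apply hU hj)).trans
    (add_le_add (entropy_le_linkBits W _) (entropy_tupleU_le W _))

/-- A lower bound for H(W_1, U_i): everything passing `P0` is a function of these two, so with the
direct link they must determine ω. -/
theorem logb_card_le_upper (Z : ZeroErrorScheme T W) (x : Index2 N) :
    Real.logb 2 (Fintype.card Ω) ≤ linkBits Msg (.direct2 x) +
      uniformEntropy (fun ω => (W (.linkW1 x) ω, W (.U x.1.2) ω)) := by
  rw [← uniformEntropy_of_injective (X := fun ω : Ω => ω) fun _ _ h => h]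
  exact (uniformEntropy_le_add (X := W (.direct2 x))
    (Y := fun ω => (W (.linkW1 x) ω, W (.U x.1.2) ω)) fun _ _ hD h =>
    Z.upper_eq x hD (Prod.ext_iff.1 h).1 (Prod.ext_iff.1 h).2).trans
    (add_le_add_left (entropy_le_linkBits W _) _)

theorem entropy_coder_le (Z : ZeroErrorScheme T W) (x : Index2 N) :
    uniformEntropy (fun ω => (W (.U x.1.2) ω, W (.V x.1.2) ω, W (.linkW1 x) ω)) ≤
      linkBits Msg (.U x.1.2) + linkBits Msg (.V x.1.2) :=
  (uniformEntropy_le_add (X := W (.U x.1.2)) (Y := W (.V x.1.2)) fun _ _ hU hV =>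
    Prod.ext hU (Prod.ext hV (Z.linkW1_eq x hU hV))).trans
    (add_le_add (entropy_le_linkBits W _) (entropy_le_linkBits W _))

theorem entropy_lowerData_le (W : ∀ e, Ω → Msg e) (x : Index2 N) :
    uniformEntropy (lowerData W x) ≤ linkBits Msg (.linkW1 x) + linkBits Msg (.linkW4 x) +
      uniformEntropy (tupleV W x.1.1) + ∑ j : {j // j ≠ x.1.2}, linkBits Msg (.U j.1) := by
  have h1 := uniformEntropy_le_add (X := W (.linkW1 x)) (Y := W (.linkW4 x))
    (W := fun ω => (W (.linkW1 x) ω, W (.linkW4 x) ω)) fun _ _ h h' => Prod.ext h h'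
  have h2 := uniformEntropy_le_add (X := tupleV W x.1.1) (Y := tupleU W x.1.2)
    (W := fun ω => (tupleV W x.1.1 ω, tupleU W x.1.2 ω)) fun _ _ h h' => Prod.ext h h'
  have h3 := uniformEntropy_le_add (X := fun ω => (W (.linkW1 x) ω, W (.linkW4 x) ω))
    (Y := fun ω => (tupleV W x.1.1 ω, tupleU W x.1.2 ω)) (W := lowerData W x)
    fun _ _ h h' => Prod.ext h h'
  have h4 := entropy_le_linkBits W (.linkW1 x)
  have h5 := entropy_le_linkBits W (.linkW4 x)
  have h6 := entropy_tupleU_le W x.1.2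
  linarith

/-- The step from `α` to `α ∪ {i}` in terms of alphabet sizes; `y` is any type 2 subnetwork for
an element other than `i`. -/
theorem entropy_tupleV_insert_le (Z : ZeroErrorScheme T W) (x y : Index2 N)
    (hy : x.1.2 ≠ y.1.2) :
    uniformEntropy (tupleV W (insert x.1.2 x.1.1)) ≤ uniformEntropy (tupleV W x.1.1) +
      (linkBits Msg (.linkW1 x) + linkBits Msg (.linkW4 x) +
        ∑ j : {j // j ≠ x.1.2}, linkBits Msg (.U j.1)) +
      (linkBits Msg (.linkW3 y) + ∑ j : {j // j ≠ y.1.2}, linkBits Msg (.U j.1) -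
        uniformEntropy (T 0)) +
      (linkBits Msg (.U x.1.2) + linkBits Msg (.V x.1.2) + linkBits Msg (.direct2 x) -
        Real.logb 2 (Fintype.card Ω)) +
      (uniformEntropy (fun ω => (tupleV W Finset.univ ω, T 1 ω)) -
        Real.logb 2 (Fintype.card Ω)) := by
  have h1 := entropy_lowerData_le W x
  have h2 := Z.entropy_U_session_zero_le y hy
  have h3 := Z.logb_card_le_upper x
  have h4 := Z.entropy_coder_le x
  have h5 := uniformEntropy_submodular (X := lowerData W x)
    (Y := fun ω => (W (.U x.1.2) ω, T 0 ω)) (Z := T 0)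
    -- Adjoining U_i is nearly free: the lower data determine S_0, which nearly determines U_i.
    (W := fun ω => (lowerData W x ω, W (.U x.1.2) ω))
    (fun _ _ h h' => Prod.ext h (Prod.ext_iff.1 h').1)
    (fun _ _ h => Z.session_zero_eq_of_lowerData x h) (fun _ _ h => (Prod.ext_iff.1 h).2)
  -- Adjoining V_i is nearly free, since it is nearly a function of (W_1, U_i).
  have h6 := uniformEntropy_submodular (X := fun ω => (lowerData W x ω, W (.U x.1.2) ω))
    (Y := fun ω => (W (.U x.1.2) ω, W (.V x.1.2) ω, W (.linkW1 x) ω))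
    (Z := fun ω => (W (.linkW1 x) ω, W (.U x.1.2) ω))
    (W := fun ω => (tupleV W (insert x.1.2 x.1.1) ω, T 0 ω))
    (fun ω ω' h h' => by
      have h7 := Prod.ext_iff.1 h
      have h8 := Prod.ext_iff.1 (Prod.ext_iff.1 h').2
      refine Prod.ext (tupleV_ext fun j hj => ?_) (Z.session_zero_eq_of_lowerData x h7.1)
      rcases Finset.mem_insert.1 hj with rfl | hj
      · exact h8.1
      · exact tupleV_apply (lowerData_iff.1 h7.1).2.1 hj)
    (fun _ _ h => Prod.ext (lowerData_iff.1 (Prod.ext_iff.1 h).1).1.1 (Prod.ext_iff.1 h).2)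
    (fun _ _ h => Prod.ext (Prod.ext_iff.1 (Prod.ext_iff.1 h).2).2 (Prod.ext_iff.1 h).1)
  -- Removing S_0 saves nearly all its bits: the V's are nearly a function of S_1, and S_0, S_1
  -- together determine ω.
  have h7 := uniformEntropy_submodular
    (X := fun ω => (tupleV W (insert x.1.2 x.1.1) ω, T 0 ω))
    (Y := fun ω => (tupleV W Finset.univ ω, T 1 ω)) (Z := tupleV W (insert x.1.2 x.1.1))
    (W := fun ω : Ω => ω)
    (fun _ _ h h' => Z.injective _ _ (Prod.ext_iff.1 h).2 (Prod.ext_iff.1 h').2)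
    (fun _ _ h => (Prod.ext_iff.1 h).1)
    (fun _ _ h => tupleV_ext fun j _ => tupleV_apply (Prod.ext_iff.1 h).1 (Finset.mem_univ j))
  rw [uniformEntropy_of_injective (X := fun ω : Ω => ω) fun _ _ h => h] at h7
  linarith

/-- If the alphabet sizes are within `ε` of the rates and capacities, then the entropies of the
messages `V_j` are close to `h`. -/
theorem abs_entropy_tupleV_sub_le [∀ s, Fintype (Src s)] (Z : ZeroErrorScheme T W) {h : Finset (Fin N) → ℝ} {ε : ℝ}
    (hε : 0 ≤ ε) (h0 : h ∅ = 0)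
    (hU : ∀ j, linkBits Msg (.U j) ≤ h {j} + ε) (hV : ∀ j, linkBits Msg (.V j) ≤ h {j} + ε)
    (hD1 : ∀ α, linkBits Msg (.direct1 α) ≤ h Finset.univ - h α.1 + ε)
    (hD2 : ∀ x, linkBits Msg (.direct2 x) ≤
      h Finset.univ + ∑ j, h {j} - 2 * h {x.1.2} + ε)
    (hW1 : ∀ x, linkBits Msg (.linkW1 x) ≤ h {x.1.2} + ε)
    (hW3 : ∀ x, linkBits Msg (.linkW3 x) ≤ h {x.1.2} + ε)
    (hW4 : ∀ x, linkBits Msg (.linkW4 x) ≤ h (insert x.1.2 x.1.1) - h x.1.1 + ε)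
    (hS0 : ∑ j, h {j} - ε ≤ Real.logb 2 (Fintype.card (Src 0)))
    (hS1 : h Finset.univ - ε ≤ Real.logb 2 (Fintype.card (Src 1)))
    (hΩ : Real.logb 2 (Fintype.card (Src 0)) + Real.logb 2 (Fintype.card (Src 1)) - ε ≤
      Real.logb 2 (Fintype.card Ω)) (α : Finset (Fin N)) :
    |uniformEntropy (tupleV W α) - h α| ≤ (N + 1) * ((6 * N + 13) * ε) := by
  classical
  have hN : (0 : ℝ) ≤ N := Nat.cast_nonneg N
  have hNε : 0 ≤ N * ε := mul_nonneg hN hε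
  have hT0 : uniformEntropy (T 0) ≤ Real.logb 2 (Fintype.card (Src 0)) :=
    uniformEntropy_le_logb_card _
  have hT1 : uniformEntropy (T 1) ≤ Real.logb 2 (Fintype.card (Src 1)) :=
    uniformEntropy_le_logb_card _
  have hT := Z.logb_card_le_add
  have hsumU : ∀ i, ∑ j : {j // j ≠ i}, linkBits Msg (.U j.1) ≤ ∑ j, h {j} - h {i} + N * ε := by
    intro i
    have h1 := Fintype.sum_eq_add_sum_subtype_ne (fun j => h {j} + ε) i
    have h2 : ∑ j : {j // j ≠ i}, linkBits Msg (.U j.1) ≤ ∑ j : {j // j ≠ i}, (h {j.1} + ε) :=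
      Finset.sum_le_sum fun j _ => hU j.1
    rw [Finset.sum_add_distrib, Finset.sum_const, Finset.card_univ, Fintype.card_fin,
      nsmul_eq_mul] at h1
    linarith
  -- The 4ε is ε from each of the two links and 2ε from H(S_1) ≥ h(N) - 2ε.
  have hVT : uniformEntropy (fun ω => (tupleV W Finset.univ ω, T 1 ω)) ≤
      uniformEntropy (T 1) + N * (4 * ε) := by
    refine (Z.entropy_tupleV_session_one_le Finset.univ).trans (add_le_add_right ?_ _)
    have : ∀ j ∈ (Finset.univ : Finset (Fin N)),
        linkBits Msg (.direct1 ⟨{j}, Finset.singleton_nonempty j⟩) +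
        linkBits Msg (.V j) - uniformEntropy (T 1) ≤ 4 * ε := by
      intro j _
      have h1 := hD1 ⟨{j}, Finset.singleton_nonempty j⟩
      have h2 := hV j
      simp only at h1
      linarith
    refine (Finset.sum_le_sum this).trans (le_of_eq ?_)
    rw [Finset.sum_const, Finset.card_univ, Fintype.card_fin, nsmul_eq_mul]
  have hempty : uniformEntropy (tupleV W ∅) = 0 :=
    uniformEntropy_of_subsingleton_range fun _ _ =>
      tupleV_ext fun j hj => absurd hj (Finset.notMem_empty j)
  -- Each inserted element costs N ε for each of two sums over U_j, 4N ε from `hVT`, and 13ε from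
  -- the remaining links, rates and log |Ω|.
  have upper : uniformEntropy (tupleV W α) ≤ h α + α.card * ((6 * N + 13) * ε) := by
    induction α using Finset.induction_on with
    | empty => simp [hempty, h0]
    | insert i α hi ih =>
      rw [Finset.card_insert_of_notMem hi]
      push_cast
      rcases α.eq_empty_or_nonempty with rfl | ⟨k, hk⟩
      · have h1 : uniformEntropy (tupleV W (insert i ∅)) ≤ linkBits Msg (.V i) :=
          (uniformEntropy_le_of_determined (X := W (.V i)) fun _ _ h =>
            tupleV_ext fun j hj => by
              have : j = i := by simpa using hj
              rw [this]; exact h).trans (entropy_le_linkBits W _)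
        have h2 := hV i
        have h3 : h (insert i ∅) = h {i} := rfl
        rw [h3, Finset.card_empty, Nat.cast_zero]
        linarith
      -- Type 2 subnetworks exist only for nonempty α; an element k of α also supplies the auxiliary
      -- one, ({i}, k). The empty case uses the link V_i alone.
      · have hki : i ≠ k := fun e => hi (e ▸ hk)
        have h1 := Z.entropy_tupleV_insert_le ⟨(α, i), ⟨k, hk⟩, hi⟩
          ⟨({i}, k), Finset.singleton_nonempty i, by simpa using hki.symm⟩ hki
        have h2 := hW1 ⟨(α, i), ⟨k, hk⟩, hi⟩
        have h3 := hW4 ⟨(α, i), ⟨k, hk⟩, hi⟩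
        have h4 := hD2 ⟨(α, i), ⟨k, hk⟩, hi⟩
        have h5 := hW3 ⟨({i}, k), Finset.singleton_nonempty i, by simpa using hki.symm⟩
        have h6 := hsumU i
        have h7 := hsumU k
        have h8 := hU i
        have h9 := hV i
        simp only at h1 h2 h3 h4 h5
        linarith
  have hcard : (α.card : ℝ) * ((6 * N + 13) * ε) ≤ (N + 1) * ((6 * N + 13) * ε) := by
    refine mul_le_mul_of_nonneg_right ?_ (by positivity)
    have : α.card ≤ N := by simpa using Finset.card_le_univ α
    have : (α.card : ℝ) ≤ N := by exact_mod_cast this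
    linarith
  have hNN : 0 ≤ N * (N * ε) := by positivity
  rw [abs_le]
  constructor
  -- The lower bound comes from the type 1 sink of α: H(V_α) ≥ H(S_1) minus its direct link.
  · rcases α.eq_empty_or_nonempty with rfl | hα
    · rw [hempty, h0]; linarith
    · have h1 := Z.entropy_session_one_le ⟨α, hα⟩
      have h2 := hD1 ⟨α, hα⟩
      simp only at h1 h2
      linarith
  · linarith

end Bounds

end ZeroErrorScheme

end Converse

/-! ## Achievable tuples come from almost entropic functions -/

section Derandomization

variable {P E S : Type} [Fintype P] [Fintype S] {G : Network P E} {M : ConnectionRequirement P S}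

/-- The event that some receiver fails. -/
def NetworkCode.failure (C : NetworkCode G M) : Set ((∀ s, C.Src s) × (∀ u, C.Rnd u)) :=
  {ω | ∃ s, ∃ u ∈ M.dest s, C.estimate u s ω ≠ ω.1 s}

-- Interchanging the two averages turns the error into a mean over the internal randomness of the
-- number of failing source tuples.
open Classical in
theorem NetworkCode.errorProb_eq_sum (C : NetworkCode G M) :
    C.errorProb * ∏ s, (Fintype.card (C.Src s) : ℝ) = ∑ v, (independentProduct C.rndLaw v).toReal *
      (Finset.univ.filter fun t : ∀ s, C.Src s => (t, v) ∈ C.failure).card := by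
  have hn : ∏ s, (Fintype.card (C.Src s) : ℝ) ≠ 0 :=
    Finset.prod_ne_zero_iff.2 fun s _ => by exact_mod_cast Fintype.card_ne_zero
  have h1 : C.errorProb = ∑ t : ∀ s, C.Src s, (∏ s, (Fintype.card (C.Src s) : ℝ))⁻¹ *
      ∑ v, if (t, v) ∈ C.failure then (independentProduct C.rndLaw v).toReal else 0 := by
    change (C.jointLaw.toOuterMeasure C.failure).toReal = _
    rw [NetworkCode.jointLaw, PMF.toOuterMeasure_bind_apply, tsum_fintype, ENNReal.toReal_sum]
    · refine Finset.sum_congr rfl fun t _ => ?_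
      rw [ENNReal.toReal_mul]
      congr 1
      · simp [independentProduct, PMF.uniformOfFintype_apply, ENNReal.toReal_prod,
          Finset.prod_inv_distrib]
      · rw [PMF.toOuterMeasure_map_apply, PMF.toOuterMeasure_apply_fintype, ENNReal.toReal_sum]
        · refine Finset.sum_congr rfl fun v _ => ?_
          by_cases h : (t, v) ∈ C.failure <;> simp [h]
        · intro v _
          rw [Set.indicator_apply]
          split_ifs
          · exact PMF.apply_ne_top _ _
          · simp
    · intro t _
      refine ENNReal.mul_ne_top (PMF.apply_ne_top _ _) ?_
      rw [PMF.toOuterMeasure_apply]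
      exact (((ENNReal.tsum_le_tsum fun v => Set.indicator_le_self _ _ v).trans
        (PMF.tsum_coe _).le).trans_lt ENNReal.one_lt_top).ne
  rw [h1, ← Finset.mul_sum, mul_comm, mul_inv_cancel_left₀ hn, Finset.sum_comm]
  refine Finset.sum_congr rfl fun v _ => ?_
  rw [← Finset.sum_filter, Finset.sum_const, nsmul_eq_mul, mul_comm]

open Classical in
/-- Some fixed value of the internal randomness is at least as good as the average. -/
theorem NetworkCode.exists_randomness (C : NetworkCode G M) : ∃ v : ∀ u, C.Rnd u,
    (1 - C.errorProb) * ∏ s, (Fintype.card (C.Src s) : ℝ) ≤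
      Nat.card {t : ∀ s, C.Src s // (t, v) ∉ C.failure} := by
  obtain ⟨v, hv⟩ : ∃ v : ∀ u, C.Rnd u, ((Finset.univ.filter fun t : ∀ s, C.Src s =>
      (t, v) ∈ C.failure).card : ℝ) ≤ C.errorProb * ∏ s, (Fintype.card (C.Src s) : ℝ) := by
    by_contra! hcon
    obtain ⟨v₀, hv₀⟩ := (independentProduct C.rndLaw).support_nonempty
    have hpos : 0 < (independentProduct C.rndLaw v₀).toReal :=
      ENNReal.toReal_pos hv₀ (PMF.apply_ne_top _ _)
    have hlt : ∑ v, (independentProduct C.rndLaw v).toReal *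
        (C.errorProb * ∏ s, (Fintype.card (C.Src s) : ℝ)) <
        ∑ v, (independentProduct C.rndLaw v).toReal *
        (Finset.univ.filter fun t : ∀ s, C.Src s => (t, v) ∈ C.failure).card :=
      Finset.sum_lt_sum
        (fun v _ => mul_le_mul_of_nonneg_left (hcon v).le (pmf_toReal_nonneg _ v))
        ⟨v₀, Finset.mem_univ _, mul_lt_mul_of_pos_left (hcon v₀) hpos⟩
    rw [← Finset.sum_mul, sum_pmf_toReal, one_mul, C.errorProb_eq_sum] at hlt
    exact lt_irrefl _ hlt
  refine ⟨v, ?_⟩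
  have h1 : (Fintype.card (∀ s, C.Src s) : ℝ) = ∏ s, (Fintype.card (C.Src s) : ℝ) := by
    rw [Fintype.card_pi, Nat.cast_prod]
  have h2 := Finset.card_filter_add_card_filter_not (s := (Finset.univ : Finset (∀ s, C.Src s)))
    fun t => (t, v) ∈ C.failure
  rw [Finset.card_univ] at h2
  have h3 : (Fintype.card (∀ s, C.Src s) : ℝ) =
      (Finset.univ.filter fun t : ∀ s, C.Src s => (t, v) ∈ C.failure).card +
      (Finset.univ.filter fun t : ∀ s, C.Src s => (t, v) ∉ C.failure).card := by
    exact_mod_cast h2.symm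
  rw [Nat.card_eq_fintype_card, Fintype.card_subtype]
  linarith

end Derandomization

/-! ### From a code with small error to a nearby almost entropic function -/

section Converse

variable {N : ℕ}

theorem NetworkCode.zeroErrorScheme (C : NetworkCode (daggerNetwork N) (daggerRequirement N))
    (v : ∀ u, C.Rnd u) : ZeroErrorScheme (Src := C.Src) (Msg := C.Msg)
      (fun s (ω : {t : ∀ s, C.Src s // (t, v) ∉ C.failure}) => ω.1 s)
      (fun e ω => C.msg e (ω.1, v)) where
  injective := fun ω ω' h0 h1 => Subtype.ext (funext fun s => by
    match s with
    | 0 => exact h0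
    | 1 => exact h1)
  causal := fun e ω ω' hs hd => by
    rw [C.causal e (ω.1, v), C.causal e (ω'.1, v)]
    have h1 : (fun s : {s // (daggerRequirement N).origin s = (daggerNetwork N).tail e} =>
        ω.1 s.1) = (fun s => ω'.1 s.1 : ∀ s : {s // _}, C.Src s.1) := funext fun s => hs s.1 s.2
    have h2 : (fun d : {d // (daggerNetwork N).head d = (daggerNetwork N).tail e} =>
        C.msg d.1 (ω.1, v)) = (fun d => C.msg d.1 (ω'.1, v) :
        ∀ d : {d // _}, C.Msg d.1) := funext fun d => hd d.1 d.2
    exact congrArg₂ (fun a b => C.encode e a b (v _)) h1 h2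
  decodable := fun s u hu ω ω' hs hd => by
    have good : ∀ ω : {t : ∀ s, C.Src s // (t, v) ∉ C.failure},
        C.estimate u s (ω.1, v) = ω.1 s := fun ω => by
      by_contra hne
      exact ω.2 ⟨s, u, hu, hne⟩
    change ω.1 s = ω'.1 s
    rw [← good ω, ← good ω']
    have h1 : (fun s : {s // (daggerRequirement N).origin s = u} => ω.1 s.1) =
        (fun s => ω'.1 s.1 : ∀ s : {s // _}, C.Src s.1) := funext fun s => hs s.1 s.2
    have h2 : (fun d : {d // (daggerNetwork N).head d = u} => C.msg d.1 (ω.1, v)) =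
        (fun d => C.msg d.1 (ω'.1, v) : ∀ d : {d // _}, C.Msg d.1) := funext fun d => hd d.1 d.2
    exact congrArg₂ (fun a b => C.decode u s a b (v _)) h1 h2

/-- The loss is expressed as a vanishing multiple of log n, not as a vanishing constant, because the
scale r may tend to 0. For n = 1 there is no loss, as m is a positive integer. -/
theorem logb_card_ge_of_mul_le {n m : ℕ} {p : ℝ} (hp0 : 0 ≤ p) (hp : p < 1) (hn : 0 < n)
    (h : (1 - p) * n ≤ m) :
    Real.logb 2 n - -Real.logb 2 (1 - p) * Real.logb 2 n ≤ Real.logb 2 m := by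
  have hn' : (0 : ℝ) < n := by exact_mod_cast hn
  have hm' : (0 : ℝ) < m := (mul_pos (by linarith) hn').trans_le h
  rcases (show n = 1 ∨ 2 ≤ n by omega) with rfl | h2
  · have : (1 : ℝ) ≤ m := by exact_mod_cast hm'
    simpa using Real.logb_nonneg (by norm_num) this
  · have h3 : 1 ≤ Real.logb 2 n := by
      rw [Real.le_logb_iff_rpow_le (by norm_num) hn', Real.rpow_one]
      exact_mod_cast h2
    have h4 : Real.logb 2 (1 - p) ≤ 0 :=
      Real.logb_nonpos (by norm_num) (by linarith) (by linarith)
    have h5 := Real.logb_le_logb_of_le (b := 2) (by norm_num)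
      (mul_pos (show 0 < 1 - p by linarith) hn') h
    rw [Real.logb_mul (by linarith) hn'.ne'] at h5
    nlinarith

/-- The approximation of the entropies obtained from a single code. -/
theorem NetworkCode.exists_isAlmostEntropic_near
    (C : NetworkCode (daggerNetwork N) (daggerRequirement N)) {h : Finset (Fin N) → ℝ} {r ε : ℝ}
    (hr : 0 < r) (hε : 0 ≤ ε) (h0 : h ∅ = 0)
    (hcap : ∀ e, ∀ c : ℝ, daggerCapacity h e = (c : WithTop ℝ) →
      Real.logb 2 (Fintype.card (C.Msg e)) / r ≤ c + ε)
    (hrate : ∀ s, daggerRate h s - ε ≤ Real.logb 2 (Fintype.card (C.Src s)) / r)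
    (hp0 : 0 ≤ C.errorProb) (hp : C.errorProb < 1)
    (herr : -Real.logb 2 (1 - C.errorProb) * (Real.logb 2 (Fintype.card (C.Src 0)) / r +
      Real.logb 2 (Fintype.card (C.Src 1)) / r) ≤ ε) :
    ∃ g, IsAlmostEntropic g ∧ ∀ α, |g α - h α| ≤ (N + 1) * ((6 * N + 13) * ε) := by
  classical
  obtain ⟨v, hv⟩ := C.exists_randomness
  set Ω := {t : ∀ s, C.Src s // (t, v) ∉ C.failure}
  have Z := C.zeroErrorScheme v
  have hc0 : (0 : ℝ) < Fintype.card (C.Src 0) := by exact_mod_cast Fintype.card_pos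
  have hc1 : (0 : ℝ) < Fintype.card (C.Src 1) := by exact_mod_cast Fintype.card_pos
  rw [Fin.prod_univ_two, ← Nat.cast_mul] at hv
  have hn : 0 < Fintype.card (C.Src 0) * Fintype.card (C.Src 1) :=
    Nat.mul_pos Fintype.card_pos Fintype.card_pos
  have hΩ : Nonempty Ω := by
    have : (0 : ℝ) < Nat.card Ω := (mul_pos (sub_pos.2 hp) (Nat.cast_pos.2 hn)).trans_le hv
    exact (Nat.card_pos_iff.1 (by exact_mod_cast this)).1
  have hlog := logb_card_ge_of_mul_le hp0 hp hn hv
  rw [Nat.cast_mul, Real.logb_mul hc0.ne' hc1.ne'] at hlog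
  have herr' : -Real.logb 2 (1 - C.errorProb) * (Real.logb 2 (Fintype.card (C.Src 0)) +
      Real.logb 2 (Fintype.card (C.Src 1))) ≤ r * ε := by
    rw [← add_div, ← mul_div_assoc, div_le_iff₀ hr] at herr
    linarith
  have hcap' : ∀ e, ∀ c : ℝ, daggerCapacity h e = (c : WithTop ℝ) →
      ZeroErrorScheme.linkBits C.Msg e ≤ r * c + r * ε := by
    intro e c hc
    have := hcap e c hc
    rw [div_le_iff₀ hr] at this
    unfold ZeroErrorScheme.linkBits
    linarith
  have hrate' : ∀ s, r * daggerRate h s - r * ε ≤ Real.logb 2 (Fintype.card (C.Src s)) := by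
    intro s
    have := hrate s
    rw [le_div_iff₀ hr] at this
    linarith
  -- The entropy bounds are homogeneous, so they are applied unnormalized, with `h` and `ε`
  -- multiplied by r.
  have key := Z.abs_entropy_tupleV_sub_le (h := fun α => r * h α) (ε := r * ε) (by positivity)
    (by simp [h0]) (fun j => hcap' (.U j) _ rfl) (fun j => hcap' (.V j) _ rfl)
    (fun α => by have := hcap' (.direct1 α) _ rfl; linarith)
    (fun x => by have := hcap' (.direct2 x) _ rfl; rw [← Finset.mul_sum]; linarith)
    (fun x => hcap' (.linkW1 x) _ rfl) (fun x => hcap' (.linkW3 x) _ rfl)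
    (fun x => by have := hcap' (.linkW4 x) _ rfl; linarith)
    (by rw [← Finset.mul_sum]; exact hrate' 0) (hrate' 1) (by
      rw [← Nat.card_eq_fintype_card (α := Ω)]
      linarith)
  have hent : IsEntropic fun α : Finset (Fin N) => uniformEntropy
      (ZeroErrorScheme.tupleV (fun e (ω : Ω) => C.msg e (ω.1, v)) α) :=
    isEntropic_uniformEntropy fun j (ω : Ω) => C.msg (.V j) (ω.1, v)
  refine ⟨_, hent.isAlmostEntropic_const_mul (inv_pos.2 hr), fun α => ?_⟩
  have h1 := key α
  rw [← mul_le_mul_iff_of_pos_left hr, ← abs_of_pos hr, ← abs_mul, abs_of_pos hr, mul_sub,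
    mul_inv_cancel_left₀ hr.ne']
  linarith

theorem NetworkCode.errorProb_nonneg {P E S : Type} [Fintype P] [Fintype S] {G : Network P E}
    {M : ConnectionRequirement P S} (C : NetworkCode G M) : 0 ≤ C.errorProb :=
  ENNReal.toReal_nonneg

theorem Achievable.isAlmostEntropic {h : Finset (Fin N) → ℝ} (h0 : h ∅ = 0)
    (hA : Achievable (daggerNetwork N) (daggerRequirement N) (daggerRate h)
      (daggerCapacity h)) : IsAlmostEntropic h := by
  obtain ⟨C, r, hr, hcap, hrate, herr⟩ := hA
  refine isAlmostEntropic_of_forall_approx fun ε hε => ?_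
  -- Chosen so that the error bound from a single code becomes exactly ε.
  set δ : ℝ := ε / ((N + 1) * (6 * N + 13)) with hδ
  have hδ0 : 0 < δ := by positivity
  have e1 : ∀ e, ∀ᶠ n in atTop, ∀ c : ℝ, daggerCapacity h e = (c : WithTop ℝ) →
      Real.logb 2 (Fintype.card ((C n).Msg e)) / r n ≤ c + δ := by
    intro e
    by_cases he : daggerCapacity h e = ⊤
    · exact Eventually.of_forall fun n c hc => by simp [he] at hc
    · obtain ⟨c, hc⟩ := WithTop.ne_top_iff_exists.1 he
      obtain ⟨a, b, -, hb, -, hbc⟩ := hcap e c hc.symm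
      filter_upwards [hb.eventually_le_const (show b < c + δ by linarith)] with n hn d hd
      rw [← hc, WithTop.coe_inj] at hd
      rwa [← hd]
  choose b _ hb hbr using hrate
  have e2 : ∀ s, ∀ᶠ n in atTop,
      daggerRate h s - δ ≤ Real.logb 2 (Fintype.card ((C n).Src s)) / r n := fun s =>
    (hb s).eventually_const_le (by linarith [hbr s])
  have e3 : ∀ᶠ n in atTop, (C n).errorProb < 1 := herr.eventually_lt_const one_pos
  have hlog : Tendsto (fun n => -Real.logb 2 (1 - (C n).errorProb)) atTop (𝓝 0) := by
    have h1 : Tendsto (fun n => 1 - (C n).errorProb) atTop (𝓝 1) := by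
      simpa using herr.const_sub 1
    have h2 := ((Real.continuousAt_log one_ne_zero).tendsto.comp h1).div_const (Real.log 2)
    simpa [Real.logb] using h2.neg
  have e4 : ∀ᶠ n in atTop, -Real.logb 2 (1 - (C n).errorProb) *
      (Real.logb 2 (Fintype.card ((C n).Src 0)) / r n +
        Real.logb 2 (Fintype.card ((C n).Src 1)) / r n) ≤ δ := by
    have := hlog.mul ((hb 0).add (hb 1))
    rw [zero_mul] at this
    exact this.eventually_le_const hδ0
  obtain ⟨n, h1, h2, h3, h4⟩ :=
    ((eventually_all.2 e1).and ((eventually_all.2 e2).and (e3.and e4))).exists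
  obtain ⟨g, hg, hgh⟩ := (C n).exists_isAlmostEntropic_near (hr n) hδ0.le h0 h1 h2
    (C n).errorProb_nonneg h3 h4
  refine ⟨g, hg, fun α => (hgh α).trans (le_of_eq ?_)⟩
  rw [hδ]
  field_simp

end Converse

end NetworkCoding

theorem mainTheorem3 (N : ℕ) :
    (∀ h : Finset (Fin N) → ℝ, h ∅ = 0 →
      (NetworkCoding.Achievable (NetworkCoding.daggerNetwork N) (NetworkCoding.daggerRequirement N)
          (NetworkCoding.daggerRate h) (NetworkCoding.daggerCapacity h) ↔
        NetworkCoding.IsAlmostEntropic h)) ∧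
    {h : Finset (Fin N) → ℝ | h ∅ = 0 ∧
        NetworkCoding.Achievable (NetworkCoding.daggerNetwork N)
          (NetworkCoding.daggerRequirement N)
          (NetworkCoding.daggerRate h) (NetworkCoding.daggerCapacity h)} =
      closure {h : Finset (Fin N) → ℝ | NetworkCoding.IsEntropic h} := by
  refine ⟨fun h h0 => ⟨fun hA => hA.isAlmostEntropic h0, fun hh => hh.achievable⟩, ?_⟩
  ext h
  rw [← NetworkCoding.isAlmostEntropic_iff_mem_closure]
  exact ⟨fun hh => hh.2.isAlmostEntropic hh.1, fun hh => ⟨hh.apply_empty, hh.achievable⟩⟩
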